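/- Let $G$ be an infinite compact (Hausdorff) abelian group with normalized Haar measure $m$ and dual group $\Gamma$ (the continuous homomorphisms from $G$ into the circle group), let $\Lambda\subset\Gamma$ and put $\Lambda^{-1}=\{\gamma^{-1}:\gamma\in\Lambda\}$. All spaces are complex. For $\Delta\subset\Gamma$ let $C_\Delta(G)$, $L^1_\Delta(G)$ and $M_\Delta(G)$ be the sets of all $f\in C(G)$, of all $f\in L^1(G)=L^1(G,m)$, and of all regular complex Borel measures $\mu$ on $G$ whose Fourier(-Stieltjes) transform, $\hat f(\gamma)=\int_G\overline{\gamma}f\,dm$ respectively $\hat\mu(\gamma)=\int_G\overline\gamma\,d\mu$, vanishes for every $\gamma\in\Gamma\setminus\Delta$; $M_\Delta(G)$ carries the total variation norm. A Banach space $X$ has the Daugavet property if $\|\mathrm{Id}+T\|=1+\|T\|$ for every bounded operator $T:X\to X$ of rank one. Let $S_X$ denote the unit sphere of $X$. A closed subspace $Y$ of a Banach space $X$ with the Daugavet property is rich in $X$ if the quotient map $\pi:X\to X/Y$ is narrow, that is, if for all $x,y\in S_X$, $x^*\in X^*$ and $\varepsilon>0$ there is $z\in S_X$ with $\|\pi(y-z)\|+|x^*(y-z)|\le\varepsilon$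 and $\|x+z\|\ge 2-\varepsilon$. (The space $L^1(G)$ has the Daugavet property.) **Theorem.** If $L^1_{\Gamma\setminus\Lambda^{-1}}(G)$ is a rich subspace of $L^1(G)$, then the quotient $C(G)/C_\Lambda(G)$ has the Daugavet property. Moreover (for every $\Lambda\subset\Gamma$, without the richness assumption) the dual space of $C(G)/C_\Lambda(G)$ is isometrically isomorphic to $M_{\Gamma\setminus\Lambda^{-1}}(G)$, a functional $\varphi$ corresponding to the measure $\mu$ with $\varphi([f])=\int_G f\,d\mu$ for all $f\in C(G)$ and $\|\varphi\|=|\mu|(G)$. -/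

import Mathlib

open MeasureTheory TopologicalSpace
open scoped Pointwise ComplexConjugate

noncomputable section

section BanachSpaces

/-- A complex Banach space `X` has the Daugavet property if every bounded operator `T : X → X` of
rank one satisfies the Daugavet equation `‖Id + T‖ = 1 + ‖T‖`. -/
def DaugavetProperty (X : Type*) [NormedAddCommGroup X] [NormedSpace ℂ X] [CompleteSpace X] :
    Prop :=
  ∀ T : X →L[ℂ] X, Module.finrank ℂ (LinearMap.range (T : X →ₗ[ℂ] X)) = 1 →
    ‖ContinuousLinearMap.id ℂ X + T‖ = 1 + ‖T‖

/-- Narrow operators between Banach spaces. Only a space `X` with the Daugavet property (or `X = 0`)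
admits a narrow operator, so that property of `X` need not be required separately. -/
def IsNarrow {X E : Type*} [NormedAddCommGroup X] [NormedSpace ℂ X] [CompleteSpace X]
    [NormedAddCommGroup E] [NormedSpace ℂ E] [CompleteSpace E] (T : X →L[ℂ] E) : Prop :=
  ∀ x y : X, ‖x‖ = 1 → ‖y‖ = 1 → ∀ (φ : StrongDual ℂ X) (ε : ℝ), 0 < ε →
    ∃ z : X, ‖z‖ = 1 ∧ ‖T (y - z)‖ + ‖φ (y - z)‖ ≤ ε ∧ 2 - ε ≤ ‖x + z‖

/-- A closed subspace `Y` of `X` is rich if the quotient map `X → X ⧸ Y` is narrow. -/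
def IsRich {X : Type*} [NormedAddCommGroup X] [NormedSpace ℂ X] [CompleteSpace X]
    (Y : Submodule ℂ X) [IsClosed (Y : Set X)] : Prop :=
  IsNarrow Y.mkQL

end BanachSpaces

section HarmonicAnalysis

variable {G : Type*} [CommGroup G] [TopologicalSpace G] [IsTopologicalGroup G] [CompactSpace G]
  [T2Space G] [MeasurableSpace G] [BorelSpace G]

variable (G) in
/-- The Haar measure of the compact group `G`, normalized to have total mass one. -/
abbrev normHaar : Measure G := Measure.haarMeasure (⊤ : PositiveCompacts G)

instance isProbabilityMeasure_normHaar : IsProbabilityMeasure (normHaar G) :=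
  ⟨by simpa using Measure.haarMeasure_self (K₀ := (⊤ : PositiveCompacts G))⟩

variable (G) in
/-- The Banach space `L¹(G)` of (classes of) complex functions integrable for Haar measure. -/
abbrev LOne : Type _ := Lp ℂ 1 (normHaar G)

/-- The Fourier coefficient `∫ conj γ · f dm` of a function `f` at a character `γ`. -/
def fourierCoef (f : G → ℂ) (γ : PontryaginDual G) : ℂ :=
  ∫ x, conj (γ x : ℂ) * f x ∂normHaar G

theorem continuous_conj_character (γ : PontryaginDual G) :
    Continuous fun x : G => conj (γ x : ℂ) :=
  Complex.continuous_conj.comp (continuous_subtype_val.comp (map_continuous γ))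

theorem norm_conj_character_mul (γ : PontryaginDual G) (x : G) (z : ℂ) :
    ‖conj (γ x : ℂ) * z‖ = ‖z‖ := by
  rw [norm_mul, RCLike.norm_conj, Circle.norm_coe, one_mul]

theorem integrable_conj_character_mul (γ : PontryaginDual G) {f : G → ℂ}
    (hf : Integrable f (normHaar G)) :
    Integrable (fun x => conj (γ x : ℂ) * f x) (normHaar G) :=
  (integrable_norm_iff ((continuous_conj_character γ).aestronglyMeasurable.mul
    hf.aestronglyMeasurable)).1 (by simpa only [Pi.mul_def, norm_conj_character_mul] using hf.norm)

theorem integrable_continuousMap (f : C(G, ℂ)) : Integrable f (normHaar G) :=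
  f.continuous.integrable_of_hasCompactSupport (HasCompactSupport.of_compactSpace f)

theorem fourierCoef_add {f g : G → ℂ} (hf : Integrable f (normHaar G))
    (hg : Integrable g (normHaar G)) (γ : PontryaginDual G) :
    fourierCoef (f + g) γ = fourierCoef f γ + fourierCoef g γ := by
  simp only [fourierCoef, Pi.add_apply, mul_add]
  exact integral_add (integrable_conj_character_mul γ hf) (integrable_conj_character_mul γ hg)

theorem fourierCoef_smul (c : ℂ) (f : G → ℂ) (γ : PontryaginDual G) :
    fourierCoef (c • f) γ = c * fourierCoef f γ := by
  simp only [fourierCoef, Pi.smul_apply, smul_eq_mul, mul_left_comm _ c]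
  exact integral_const_mul c _

theorem fourierCoef_congr {f g : G → ℂ} (h : f =ᵐ[normHaar G] g) (γ : PontryaginDual G) :
    fourierCoef f γ = fourierCoef g γ :=
  integral_congr_ae (h.mono fun x hx => by simp only [hx])

theorem norm_fourierCoef_le (f : G → ℂ) (γ : PontryaginDual G) :
    ‖fourierCoef f γ‖ ≤ ∫ x, ‖f x‖ ∂normHaar G :=
  (norm_integral_le_integral_norm _).trans_eq (by simp only [norm_conj_character_mul])

/-- `C_Λ(G)`: the continuous functions `f` on `G` with spectrum `{γ | f̂(γ) ≠ 0}` contained in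
`Λ`. -/
def contSpec (Λ : Set (PontryaginDual G)) : Submodule ℂ C(G, ℂ) where
  carrier := {f | ∀ γ, fourierCoef f γ ≠ 0 → γ ∈ Λ}
  zero_mem' := fun γ h => absurd (by simp [fourierCoef]) h
  add_mem' := by
    intro f g hf hg γ h
    by_contra hγ
    refine h ?_
    rw [ContinuousMap.coe_add, fourierCoef_add (integrable_continuousMap f)
      (integrable_continuousMap g), not_not.1 (mt (hf γ) hγ), not_not.1 (mt (hg γ) hγ), add_zero]
  smul_mem' := by
    intro c f hf γ h
    by_contra hγ
    refine h ?_
    rw [ContinuousMap.coe_smul, fourierCoef_smul, not_not.1 (mt (hf γ) hγ), mul_zero]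

/-- `L¹_Λ(G)`: the elements `f` of `L¹(G)` with spectrum `{γ | f̂(γ) ≠ 0}` contained in `Λ`. -/
def lOneSpec (Λ : Set (PontryaginDual G)) : Submodule ℂ (LOne G) where
  carrier := {f | ∀ γ, fourierCoef f γ ≠ 0 → γ ∈ Λ}
  zero_mem' := fun γ h => absurd
    ((fourierCoef_congr (Lp.coeFn_zero ℂ 1 (normHaar G)) γ).trans (by simp [fourierCoef])) h
  add_mem' := by
    intro f g hf hg γ h
    by_contra hγ
    refine h ?_
    rw [fourierCoef_congr (Lp.coeFn_add f g), fourierCoef_add (L1.integrable_coeFn f)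
      (L1.integrable_coeFn g), not_not.1 (mt (hf γ) hγ), not_not.1 (mt (hg γ) hγ), add_zero]
  smul_mem' := by
    intro c f hf γ h
    by_contra hγ
    refine h ?_
    rw [fourierCoef_congr (Lp.coeFn_smul c f), fourierCoef_smul, not_not.1 (mt (hf γ) hγ),
      mul_zero]

theorem fourierCoef_sub {f g : G → ℂ} (hf : Integrable f (normHaar G))
    (hg : Integrable g (normHaar G)) (γ : PontryaginDual G) :
    fourierCoef (f - g) γ = fourierCoef f γ - fourierCoef g γ := by
  simp only [fourierCoef, Pi.sub_apply, mul_sub]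
  exact integral_sub (integrable_conj_character_mul γ hf) (integrable_conj_character_mul γ hg)

theorem continuous_fourierCoef_lOne (γ : PontryaginDual G) :
    Continuous fun f : LOne G => fourierCoef f γ := by
  refine LipschitzWith.continuous (K := 1) (LipschitzWith.of_dist_le_mul fun f g => ?_)
  rw [NNReal.coe_one, one_mul, dist_eq_norm, dist_eq_norm,
    ← fourierCoef_sub (L1.integrable_coeFn f) (L1.integrable_coeFn g),
    ← fourierCoef_congr (Lp.coeFn_sub f g), L1.norm_eq_integral_norm]
  exact norm_fourierCoef_le _ γ

theorem continuous_fourierCoef_cont (γ : PontryaginDual G) :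
    Continuous fun f : C(G, ℂ) => fourierCoef f γ := by
  refine LipschitzWith.continuous (K := 1) (LipschitzWith.of_dist_le_mul fun f g => ?_)
  rw [NNReal.coe_one, one_mul, dist_eq_norm, dist_eq_norm,
    ← fourierCoef_sub (integrable_continuousMap f) (integrable_continuousMap g),
    ← ContinuousMap.coe_sub]
  refine (norm_fourierCoef_le _ γ).trans ?_
  refine (integral_mono (integrable_continuousMap (f - g)).norm (integrable_const ‖f - g‖)
    fun x => (f - g).norm_coe_le_norm x).trans_eq ?_
  simp

instance isClosed_contSpec (Λ : Set (PontryaginDual G)) :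
    IsClosed (contSpec Λ : Set C(G, ℂ)) := by
  have : (contSpec Λ : Set C(G, ℂ)) = ⋂ γ ∈ Λᶜ, {f : C(G, ℂ) | fourierCoef f γ = 0} := by
    ext f
    simp only [contSpec, Set.mem_iInter, Set.mem_compl_iff, Set.mem_ofPred_eq]
    exact forall_congr' fun γ => by tauto
  rw [this]
  exact isClosed_biInter fun γ _ => isClosed_eq (continuous_fourierCoef_cont γ) continuous_const

instance isClosed_lOneSpec (Λ : Set (PontryaginDual G)) :
    IsClosed (lOneSpec Λ : Set (LOne G)) := by
  have : (lOneSpec Λ : Set (LOne G)) = ⋂ γ ∈ Λᶜ, {f : LOne G | fourierCoef f γ = 0} := by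
    ext f
    simp only [lOneSpec, Set.mem_iInter, Set.mem_compl_iff, Set.mem_ofPred_eq]
    exact forall_congr' fun γ => by tauto
  rw [this]
  exact isClosed_biInter fun γ _ => isClosed_eq (continuous_fourierCoef_lOne γ) continuous_const

/-- The integral `∫ f dμ` of a complex function against a complex measure. -/
def cintegral (μ : ComplexMeasure G) (f : G → ℂ) : ℂ :=
  VectorMeasure.integral μ f (ContinuousLinearMap.mul ℝ ℂ)

/-- `M_Λ(G)`: the regular complex Borel measures `μ` on `G` whose Fourier-Stieltjes transform
`μ̂(γ) = ∫ conj γ dμ` vanishes outside `Λ`. A complex measure is regular when its total variation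
measure is. -/
def measSpec (Λ : Set (PontryaginDual G)) : Set (ComplexMeasure G) :=
  {μ | μ.variation.Regular ∧ ∀ γ : PontryaginDual G,
    cintegral μ (fun x => conj (γ x : ℂ)) ≠ 0 → γ ∈ Λ}

end HarmonicAnalysis

end

set_option linter.unusedSectionVars false

/-! The dual of $C(G)/C_\Lambda(G)$ is the annihilator of $C_\Lambda(G)$, a space of regular
measures by the Riesz theorem (`exists_unimodular_density`). To annihilate $C_\Lambda(G)$ it
suffices to kill the characters in $\Lambda$ (`apply_eq_zero_of_mem_contSpec`): the Fourier
coefficients of $x\mapsto\varphi(f(x\,\cdot))$ are $\hat f(\gamma)\varphi(\gamma)$, all zero, so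
this function vanishes by uniqueness of Fourier coefficients. Uniqueness itself comes from Gelfand
theory for the bicommutant of the regular representation.

For the Daugavet property, `daugavetProperty_of_dual` asks, given a functional $\varphi$ and a unit
vector $[f]$, for a functional $\psi$ in the unit ball with $\psi([f])\approx 1$ and
$\|\varphi+\psi\|\approx\|\varphi\|+1$. It is sought among the densities in
$L^1_{\Gamma\setminus\Lambda^{-1}}(G)$. Such a density does not meet the singular part of the
measure of $\varphi$, so only the absolutely continuous part $u$ matters
(`exists_absolutelyContinuous_part`). Smoothing a norming functional of $[f]$ by an approximate unit
gives a unit vector $y$ of the subspace with $\int fy\,dm\approx 1$ (`exists_unit_mem_lOneSpec`).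
Richness exchanges $y$ for a unit vector $z$ which is almost in the subspace, has almost the same
integral against $f$, and is almost $\ell^1$-orthogonal to $u$. The function $u$ itself need not lie
in the subspace, which is why richness in all of $L^1(G)$ is the relevant hypothesis. A small
correction of $z$ and a rescaling give $\psi$. -/

noncomputable section

/-! ### Gelfand theory for commutative star subalgebras. -/

section CommutativeStarAlgebra

/-- A closed star subalgebra with commutative multiplication is a commutative C⋆-algebra. -/
abbrev StarSubalgebra.commCStarAlgebraOfComm {A : Type*} [CStarAlgebra A] (S : StarSubalgebra ℂ A)
    (hS : IsClosed (S : Set A)) (hcomm : ∀ a ∈ S, ∀ b ∈ S, a * b = b * a) : CommCStarAlgebra S :=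
  letI : CStarAlgebra S := StarSubalgebra.cstarAlgebra S (h_closed := hS)
  { (inferInstance : CStarAlgebra S) with
    mul_comm := fun a b => Subtype.ext (hcomm a a.2 b b.2) }

/-- Characters of a commutative unital C⋆-algebra separate points from zero. -/
theorem exists_character_ne_zero {A : Type*} [CommCStarAlgebra A] {a : A} (ha : a ≠ 0) :
    ∃ χ : WeakDual.characterSpace ℂ A, χ a ≠ 0 := by
  by_contra! h
  refine ha ((gelfandTransform_isometry A).injective ?_)
  rw [map_zero]
  ext χ
  exact h χ

end CommutativeStarAlgebra

/-! ### Integrated unitary representations and their bicommutant. -/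

section UnitaryRepresentation

variable {G : Type*} [CommGroup G] [TopologicalSpace G] [IsTopologicalGroup G] [CompactSpace G]
  [T2Space G] [MeasurableSpace G] [BorelSpace G]
  {H : Type*} [NormedAddCommGroup H] [InnerProductSpace ℂ H] [CompleteSpace H]

theorem integrable_of_continuous {E : Type*} [NormedAddCommGroup E] {f : G → E}
    (hf : Continuous f) : Integrable f (normHaar G) :=
  hf.integrable_of_hasCompactSupport (HasCompactSupport.of_compactSpace f)

/-- The operator `∫ k(y) τ(y) dy`, defined weakly. -/
def repIntegral (τ : G →* (H →L[ℂ] H)) (hτ : ∀ v, Continuous fun x => τ x v)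
    (hiso : ∀ x v, ‖τ x v‖ = ‖v‖) (k : C(G, ℂ)) : H →L[ℂ] H :=
  LinearMap.mkContinuous
    { toFun := fun v => ∫ y, k y • τ y v ∂normHaar G
      map_add' := fun u v => by
        simp only [map_add, smul_add]
        exact integral_add (integrable_of_continuous (k.continuous.smul (hτ u)))
          (integrable_of_continuous (k.continuous.smul (hτ v)))
      map_smul' := fun c v => by
        simp only [map_smul, smul_comm _ c, RingHom.id_apply]
        exact integral_smul c _ } ‖k‖ fun v => by
    refine (norm_integral_le_of_norm_le_const (C := ‖k‖ * ‖v‖)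
      (Filter.Eventually.of_forall fun y => ?_)).trans_eq (by simp)
    rw [norm_smul, hiso]
    exact mul_le_mul_of_nonneg_right (k.norm_coe_le_norm y) (norm_nonneg _)

variable (τ : G →* (H →L[ℂ] H)) (hτ : ∀ v, Continuous fun x => τ x v)
  (hiso : ∀ x v, ‖τ x v‖ = ‖v‖)

theorem repIntegral_apply (k : C(G, ℂ)) (v : H) :
    repIntegral τ hτ hiso k v = ∫ y, k y • τ y v ∂normHaar G := rfl

theorem norm_repIntegral_le (k : C(G, ℂ)) : ‖repIntegral τ hτ hiso k‖ ≤ ‖k‖ :=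
  LinearMap.mkContinuous_norm_le _ (norm_nonneg _) _

theorem repIntegral_sub (k l : C(G, ℂ)) :
    repIntegral τ hτ hiso (k - l) = repIntegral τ hτ hiso k - repIntegral τ hτ hiso l := by
  ext v
  simp only [_root_.sub_apply, repIntegral_apply, ContinuousMap.sub_apply, sub_smul]
  exact integral_sub (integrable_of_continuous (k.continuous.smul (hτ v)))
    (integrable_of_continuous (l.continuous.smul (hτ v)))

/-- The shift `y ↦ f (x * y)` of a continuous function, depending continuously on `x`. -/
def shift (f : C(G, ℂ)) : C(G, C(G, ℂ)) :=
  ContinuousMap.curry ⟨fun p : G × G => f (p.1 * p.2), by fun_prop⟩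

@[simp] theorem shift_apply (f : C(G, ℂ)) (x y : G) : shift f x y = f (x * y) := rfl

theorem mul_repIntegral (x : G) (k : C(G, ℂ)) :
    τ x * repIntegral τ hτ hiso k = repIntegral τ hτ hiso (shift k x⁻¹) := by
  ext v
  simp only [mul_apply_eq_comp, repIntegral_apply, shift_apply]
  rw [← ContinuousLinearMap.integral_comp_comm _
    (integrable_of_continuous (k.continuous.smul (hτ v)) : Integrable (fun y => k y • τ y v) _),
    ← integral_mul_left_eq_self (fun y => k (x⁻¹ * y) • τ y v) x]
  simp

theorem repIntegral_commute (k : C(G, ℂ)) (S : H →L[ℂ] H) (hS : ∀ x, S * τ x = τ x * S) :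
    S * repIntegral τ hτ hiso k = repIntegral τ hτ hiso k * S := by
  ext v
  simp only [mul_apply_eq_comp, repIntegral_apply]
  rw [← ContinuousLinearMap.integral_comp_comm _
    (integrable_of_continuous (k.continuous.smul (hτ v)) : Integrable (fun y => k y • τ y v) _)]
  refine integral_congr_ae (Filter.Eventually.of_forall fun y => ?_)
  simp only [map_smul]
  rw [← mul_apply_eq_comp, hS, mul_apply_eq_comp]

/-- The representation is only strongly continuous, but multiplication by $\tau(x)$ can be moved
onto the kernel as a translation. Translation is continuous in the sup norm, which dominates the
operator norm. -/
theorem continuous_mul_repIntegral (k : C(G, ℂ)) :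
    Continuous fun x => τ x * repIntegral τ hτ hiso k := by
  simp only [mul_repIntegral]
  have h : Continuous fun f : C(G, ℂ) => repIntegral τ hτ hiso f := by
    refine LipschitzWith.continuous (K := 1) (LipschitzWith.of_dist_le_mul fun f g => ?_)
    rw [NNReal.coe_one, one_mul, dist_eq_norm, dist_eq_norm, ← repIntegral_sub]
    exact norm_repIntegral_le _ _ _ _
  exact h.comp ((shift k).continuous.comp continuous_inv)

theorem star_rep {τ : G →* (H →L[ℂ] H)} (hiso : ∀ x v, ‖τ x v‖ = ‖v‖)
    (x : G) : star (τ x) = τ x⁻¹ := by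
  rw [ContinuousLinearMap.star_eq_adjoint]
  refine (ContinuousLinearMap.eq_adjoint_iff _ _).2 (fun u v => ?_) |>.symm
  let L : H →ₗᵢ[ℂ] H := ⟨(τ x : H →ₗ[ℂ] H), hiso x⟩
  have h := L.inner_map_map (τ x⁻¹ u) v
  have h2 : L (τ x⁻¹ u) = u := by
    change (τ x * τ x⁻¹) u = u
    rw [← map_mul, mul_inv_cancel, map_one, one_apply_eq_self]
  rw [h2] at h
  exact h.symm

/-- Let `T` be an element of the bicommutant of a unitary representation `τ` in a C⋆-algebra which
acts like `∫ k(y) τ(y) dy`. If `T ≠ 0`, then some Fourier coefficient of `k` is nonzero. -/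
theorem exists_fourierCoef_ne_zero_of_bicommutant {𝒜 : Type*} [CStarAlgebra 𝒜] (τ : G →* 𝒜)
    (hstar : ∀ x, star (τ x) = τ x⁻¹) (T : 𝒜) (hT : ∀ S, (∀ x, S * τ x = τ x * S) → S * T = T * S)
    (hcont : Continuous fun x => τ x * T) (k : C(G, ℂ))
    (hk : T * T = ∫ y, k y • (τ y * T) ∂normHaar G) (hT0 : T ≠ 0) :
    ∃ γ : PontryaginDual G, fourierCoef k γ ≠ 0 := by
  -- `B` is the commutant of $\tau(G)$ and `A` the bicommutant. Since $G$ is commutative,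
  -- $\tau(G)\subset B$, hence $A\subset B$; as `A` commutes with `B`, it is commutative.
  let B := StarSubalgebra.centralizer ℂ (Set.range τ)
  let A := StarSubalgebra.centralizer ℂ (B : Set 𝒜)
  have hτB : ∀ x, τ x ∈ B := fun x => StarSubalgebra.mem_centralizer_iff ℂ |>.2 <| by
    rintro _ ⟨y, rfl⟩
    rw [hstar, ← map_mul, ← map_mul, ← map_mul, ← map_mul, mul_comm x, mul_comm x]
    exact ⟨rfl, rfl⟩
  have hAB : ∀ a ∈ A, a ∈ B := fun a ha => StarSubalgebra.mem_centralizer_iff ℂ |>.2 <| by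
    rintro _ ⟨y, rfl⟩
    exact StarSubalgebra.mem_centralizer_iff ℂ |>.1 ha _ (hτB y)
  have hcomm : ∀ a ∈ A, ∀ b ∈ A, a * b = b * a := fun a ha b hb =>
    (StarSubalgebra.mem_centralizer_iff ℂ |>.1 hb _ (hAB a ha)).1
  have hclosed : IsClosed (A : Set 𝒜) := Set.isClosed_centralizer _
  have hBτ : ∀ S ∈ B, ∀ x, S * τ x = τ x * S := fun S hS x =>
    (StarSubalgebra.mem_centralizer_iff ℂ |>.1 hS _ ⟨x, rfl⟩).1.symm
  have hτA : ∀ x, τ x ∈ A := fun x => StarSubalgebra.mem_centralizer_iff ℂ |>.2 fun S hS =>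
    ⟨hBτ S hS x, hBτ _ (star_mem hS) x⟩
  have hTA : T ∈ A := StarSubalgebra.mem_centralizer_iff ℂ |>.2 fun S hS =>
    ⟨hT S (hBτ S hS), hT _ (hBτ _ (star_mem hS))⟩
  let _ : CommCStarAlgebra A := A.commCStarAlgebraOfComm hclosed hcomm
  let t : A := ⟨T, hTA⟩
  let u : G →* A :=
    { toFun := fun x => ⟨τ x, hτA x⟩
      map_one' := Subtype.ext (map_one τ)
      map_mul' := fun x y => Subtype.ext (map_mul τ x y) }
  obtain ⟨χ, hχ⟩ := exists_character_ne_zero (a := t) fun h => hT0 (congrArg Subtype.val h)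
  have hut : Continuous fun x => u x * t := hcont.subtype_mk _
  have hint : Integrable (fun y => k y • (u y * t)) (normHaar G) :=
    integrable_of_continuous (k.continuous.smul hut)
  have htt : t * t = ∫ y, k y • (u y * t) ∂normHaar G := by
    refine Subtype.ext (hk.trans ?_)
    let ι : A →L[ℂ] 𝒜 := ⟨A.subtype.toLinearMap, continuous_subtype_val⟩
    exact ι.integral_comp_comm hint
  -- Continuity of $\tau$ in norm is not available; the factor `t` supplies it, and $\chi(t)\ne 0$
  -- can be divided out.
  have hχu : Continuous fun x => χ (u x) := by
    have : (fun x => χ (u x)) = fun x => χ (u x * t) / χ t := by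
      ext x
      rw [map_mul, mul_div_cancel_right₀ _ hχ]
    rw [this]
    exact (((map_continuous χ).comp hut).div_const _)
  have hmul : ∀ x, χ (u x) * χ (u x⁻¹) = 1 := fun x => by
    rw [← map_mul, ← map_mul, mul_inv_cancel, map_one, map_one]
  have : Nontrivial A := ⟨t, 0, fun h => hT0 (congrArg Subtype.val h)⟩
  have hle : ∀ x, ‖χ (u x)‖ ≤ 1 := fun x => by
    have hux : u x ∈ unitary A := by
      have hs : star (u x) = u x⁻¹ := Subtype.ext (hstar x)
      rw [Unitary.mem_iff, hs, ← map_mul, ← map_mul, inv_mul_cancel, mul_inv_cancel, map_one]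
      exact ⟨rfl, rfl⟩
    exact (AlgHom.norm_apply_le_self χ (u x)).trans_eq (CStarRing.norm_of_mem_unitary hux)
  have hone : ∀ x, ‖χ (u x)‖ = 1 := fun x => by
    refine le_antisymm (hle x) ?_
    have h2 := congrArg norm (hmul x)
    rw [norm_mul, norm_one] at h2
    nlinarith [hle x⁻¹, norm_nonneg (χ (u x)), norm_nonneg (χ (u x⁻¹))]
  let γ : PontryaginDual G :=
    { toFun := fun x => ⟨χ (u x), mem_sphere_zero_iff_norm.2 (hone x)⟩
      map_one' := Subtype.ext (by simp)
      map_mul' := fun x y => Subtype.ext (by simp; rfl)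
      continuous_toFun := hχu.subtype_mk _ }
  have key : χ t = ∫ y, k y * χ (u y) ∂normHaar G := by
    let χ' : A →L[ℂ] ℂ := WeakDual.CharacterSpace.toCLM χ
    have h := congrArg χ' htt
    rw [← χ'.integral_comp_comm hint] at h
    have h' : χ t * χ t = (∫ y, k y * χ (u y) ∂normHaar G) * χ t := by
      rw [← map_mul, ← integral_mul_const]
      refine h.trans (integral_congr_ae (Filter.Eventually.of_forall fun y => ?_))
      change χ (k y • (u y * t)) = _
      rw [map_smul, map_mul, smul_eq_mul, ← mul_assoc]
    exact mul_right_cancel₀ hχ h'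
  -- The coefficient at $\gamma$ integrates against $\overline\gamma$, so $\int k\gamma\,dm$ is the
  -- coefficient at $\gamma^{-1}$.
  refine ⟨γ⁻¹, fun h => hχ ?_⟩
  rw [key, ← h, fourierCoef]
  refine integral_congr_ae (Filter.Eventually.of_forall fun y => ?_)
  have h1 : (γ⁻¹ : PontryaginDual G) y = (γ y)⁻¹ := rfl
  simp only [h1, Circle.coe_inv_eq_conj, Complex.conj_conj]
  exact mul_comm _ _

/-- If `∫ k(y) τ(y) dy ≠ 0` for a unitary representation `τ`, then some Fourier coefficient of `k`
is nonzero. -/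
theorem exists_fourierCoef_ne_zero_of_repIntegral (k : C(G, ℂ))
    (hk : repIntegral τ hτ hiso k ≠ 0) : ∃ γ : PontryaginDual G, fourierCoef k γ ≠ 0 := by
  refine exists_fourierCoef_ne_zero_of_bicommutant τ (star_rep hiso) _
    (repIntegral_commute τ hτ hiso k) (continuous_mul_repIntegral τ hτ hiso k) k ?_ hk
  ext v
  have hint : Integrable (fun y => k y • (τ y * repIntegral τ hτ hiso k)) (normHaar G) :=
    integrable_of_continuous (k.continuous.smul (continuous_mul_repIntegral τ hτ hiso k))
  rw [ContinuousLinearMap.integral_apply hint]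
  rfl

end UnitaryRepresentation

/-! ### Uniqueness of Fourier coefficients through the regular representation. -/

section Uniqueness

variable {G : Type*} [CommGroup G] [TopologicalSpace G] [IsTopologicalGroup G] [CompactSpace G]
  [T2Space G] [MeasurableSpace G] [BorelSpace G]

variable (G) in
/-- The regular representation of `G` on `L²(G)`. -/
def regularRep : G →* (Lp ℂ 2 (normHaar G) →L[ℂ] Lp ℂ 2 (normHaar G)) where
  toFun x := LinearMap.mkContinuous
    { toFun := fun v => DomMulAct.mk x • v
      map_add' := smul_add _
      map_smul' := fun c v => smul_comm _ c v } 1 fun v => by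
    rw [one_mul]
    exact (DomMulAct.norm_smul_Lp _ _).le
  map_one' := by
    ext1 v
    exact one_smul Gᵈᵐᵃ v
  map_mul' x y := by
    ext1 v
    change DomMulAct.mk (x * y) • v = DomMulAct.mk x • DomMulAct.mk y • v
    rw [smul_smul, mul_comm x y]
    rfl

theorem regularRep_apply (x : G) (v : Lp ℂ 2 (normHaar G)) :
    regularRep G x v = DomMulAct.mk x • v := rfl

theorem continuous_regularRep (v : Lp ℂ 2 (normHaar G)) : Continuous fun x => regularRep G x v := by
  simp only [regularRep_apply]
  have : Fact ((2 : ENNReal) ≠ ⊤) := ⟨ENNReal.ofNat_ne_top⟩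
  exact (DomMulAct.continuous_mk).smul continuous_const

theorem regularRep_toLp (x : G) (f : C(G, ℂ)) :
    regularRep G x (ContinuousMap.toLp 2 (normHaar G) ℂ f) =
      ContinuousMap.toLp 2 (normHaar G) ℂ (shift f x) := rfl

/-- A continuous function on a compact abelian group is determined by its Fourier coefficients. -/
theorem eq_zero_of_fourierCoef_eq_zero (f : C(G, ℂ)) (hf : ∀ γ, fourierCoef f γ = 0) : f = 0 := by
  have h0 : repIntegral (regularRep G) continuous_regularRep
      (fun x v => DomMulAct.norm_smul_Lp _ _) f = 0 := by
    by_contra h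
    obtain ⟨γ, hγ⟩ := exists_fourierCoef_ne_zero_of_repIntegral _ _ _ f h
    exact hγ (hf γ)
  -- The operator $\int f(y)\tau(y)\,dy$ is zero; applied to $\overline f$ it gives a continuous
  -- function whose value at $1$ is $\int|f|^2\,dm$.
  let g : C(G, ℂ) := star f
  have hint : Integrable (fun y => f y • shift g y) (normHaar G) :=
    integrable_of_continuous (f.continuous.smul (shift g).continuous)
  have h1 : ContinuousMap.toLp 2 (normHaar G) ℂ (∫ y, f y • shift g y ∂normHaar G) = 0 := by
    rw [← ContinuousLinearMap.integral_comp_comm _ hint]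
    have := congrArg (fun S => S (ContinuousMap.toLp 2 (normHaar G) ℂ g)) h0
    simpa only [repIntegral_apply, regularRep_toLp, map_smul] using! this
  have h2 : ∫ y, f y • shift g y ∂normHaar G = 0 :=
    ContinuousMap.toLp_injective (normHaar G) (𝕜 := ℂ) (p := 2) (by rw [h1, map_zero])
  have h3 : ∫ y, ‖f y‖ ^ 2 ∂normHaar G = 0 := by
    have h4 := congrArg (ContinuousMap.evalCLM ℂ (1 : G)) h2
    rw [← ContinuousLinearMap.integral_comp_comm _ hint, map_zero] at h4
    have h5 : ((∫ y, ‖f y‖ ^ 2 ∂normHaar G : ℝ) : ℂ) = 0 := by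
      rw [← h4, ← integral_complex_ofReal]
      refine integral_congr_ae (Filter.Eventually.of_forall fun y => ?_)
      simp [g, Complex.mul_conj, Complex.normSq_eq_norm_sq]
    exact_mod_cast h5
  have hcont : Continuous fun y => ‖f y‖ ^ 2 := by fun_prop
  have h4 := (hcont.ae_eq_iff_eq (normHaar G) continuous_const).1
    ((integral_eq_zero_iff_of_nonneg (fun y => by positivity) (integrable_of_continuous hcont)).1 h3)
  ext y
  exact norm_eq_zero.1 ((sq_eq_zero_iff).1 (congrFun h4 y))

end Uniqueness

/-! ### The Riesz representation theorem for complex functionals on $C(X)$. -/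

section ComplexRiesz

open scoped NNReal

variable {X : Type*} [TopologicalSpace X] [CompactSpace X] [T2Space X]

/-- The modulus of a bounded functional `φ` on `C(X)` at a nonnegative function `f`: the supremum
of `‖φ g‖` over all `g` dominated by `f`. -/
def dualModulus (φ : StrongDual ℂ C(X, ℂ)) (f : X → ℝ≥0) : ℝ≥0 :=
  sSup {r | ∃ g : C(X, ℂ), (∀ x, ‖g x‖ ≤ f x) ∧ r = ‖φ g‖₊}

variable (φ : StrongDual ℂ C(X, ℂ))

theorem bddAbove_dualModulus (f : C(X, ℝ≥0)) :
    BddAbove {r | ∃ g : C(X, ℂ), (∀ x, ‖g x‖ ≤ f x) ∧ r = ‖φ g‖₊} := by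
  let f' : C(X, ℝ) := ⟨fun x => f x, by fun_prop⟩
  refine ⟨‖φ‖₊ * ‖f'‖₊, ?_⟩
  rintro _ ⟨g, hg, rfl⟩
  refine (φ.le_opNNNorm g).trans (mul_le_mul_right ?_ _)
  refine (ContinuousMap.norm_le _ (norm_nonneg _)).2 fun x => (hg x).trans ?_
  exact (le_abs_self _).trans (f'.norm_coe_le_norm x)

theorem nnnorm_le_dualModulus (f : C(X, ℝ≥0)) {g : C(X, ℂ)} (hg : ∀ x, ‖g x‖ ≤ f x) :
    ‖φ g‖₊ ≤ dualModulus φ f :=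
  le_csSup (bddAbove_dualModulus φ f) ⟨g, hg, rfl⟩

theorem dualModulus_le (f : C(X, ℝ≥0)) {C : ℝ≥0}
    (h : ∀ g : C(X, ℂ), (∀ x, ‖g x‖ ≤ f x) → ‖φ g‖₊ ≤ C) : dualModulus φ f ≤ C :=
  csSup_le' (by rintro _ ⟨g, hg, rfl⟩; exact h g hg)

theorem exists_phase (z : ℂ) : ∃ c : ℂ, ‖c‖ ≤ 1 ∧ c * z = ‖z‖ := by
  refine ⟨conj z / ‖z‖, ?_, ?_⟩
  · rw [norm_div, RCLike.norm_conj, Complex.norm_real, norm_norm]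
    exact div_self_le_one _
  · rcases eq_or_ne z 0 with rfl | hz
    · simp
    · have : (‖z‖ : ℂ) ≠ 0 := by exact_mod_cast norm_ne_zero_iff.2 hz
      field_simp
      rw [Complex.conj_mul']

/-- For $\le$, a function dominated by $f_1+f_2$ is split in the ratio $f_1:f_2$; since the sum may
vanish, $\delta$ is added to the denominator, leaving a third piece of norm at most $\delta$. For
$\ge$, phases rotate $\varphi(g_1)$ and $\varphi(g_2)$ onto the positive axis, where their moduli
add. -/
theorem dualModulus_add (f₁ f₂ : C(X, ℝ≥0)) :
    dualModulus φ (f₁ + f₂ : C(X, ℝ≥0)) = dualModulus φ f₁ + dualModulus φ f₂ := by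
  apply le_antisymm
  · refine dualModulus_le φ _ fun g hg => ?_
    rw [← NNReal.coe_le_coe]
    refine le_of_forall_pos_le_add fun ε hε => ?_
    let δ : ℝ := ε / (‖φ‖ + 1)
    have hδ : 0 < δ := by positivity
    let s : C(X, ℝ) := ⟨fun x => f₁ x + f₂ x + δ, by fun_prop⟩
    have hs : ∀ x, 0 < s x := fun x => by simp only [s, ContinuousMap.coe_mk]; positivity
    have hs' : ∀ x, (s x : ℂ) ≠ 0 := fun x => by exact_mod_cast (hs x).ne'
    have hg' : ∀ x, ‖g x‖ ≤ s x := fun x => (hg x).trans (by simp [s, hδ.le])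
    have aux : ∀ x (a : ℝ), 0 ≤ a → ‖g x * (a / s x)‖ ≤ a := fun x a ha => by
      rw [norm_mul, norm_div, Complex.norm_real, Complex.norm_real, Real.norm_of_nonneg ha,
        Real.norm_of_nonneg (hs x).le, ← mul_div_assoc, div_le_iff₀ (hs x), mul_comm]
      exact mul_le_mul_of_nonneg_left (hg' x) ha
    let part : C(X, ℝ) → C(X, ℂ) := fun a =>
      ⟨fun x => g x * ((a x : ℂ) / (s x : ℂ)), g.continuous.mul
        ((Complex.continuous_ofReal.comp a.continuous).div
          (Complex.continuous_ofReal.comp s.continuous) hs')⟩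
    let r₁ : C(X, ℝ) := ⟨fun x => f₁ x, by fun_prop⟩
    let r₂ : C(X, ℝ) := ⟨fun x => f₂ x, by fun_prop⟩
    have hsum : g = part r₁ + part r₂ + part (ContinuousMap.const X δ) := by
      ext x
      simp only [part, r₁, r₂, ContinuousMap.add_apply, ContinuousMap.coe_mk,
        ContinuousMap.const_apply]
      rw [← mul_add, ← mul_add, ← add_div, ← add_div, div_eq_one_iff_eq (hs' x) |>.2, mul_one]
      simp [s]
    have h1 : ‖φ (part r₁)‖ ≤ dualModulus φ f₁ :=
      nnnorm_le_dualModulus φ f₁ fun x => aux x _ (f₁ x).2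
    have h2 : ‖φ (part r₂)‖ ≤ dualModulus φ f₂ :=
      nnnorm_le_dualModulus φ f₂ fun x => aux x _ (f₂ x).2
    have h3 : ‖φ (part (ContinuousMap.const X δ))‖ ≤ ε := by
      have h4 : ‖part (ContinuousMap.const X δ)‖ ≤ δ :=
        (ContinuousMap.norm_le _ hδ.le).2 fun x => aux x _ hδ.le
      refine (φ.le_opNorm_of_le h4).trans ?_
      rw [← mul_div_assoc, div_le_iff₀ (by positivity)]
      nlinarith [norm_nonneg φ]
    rw [hsum, map_add, map_add, coe_nnnorm, NNReal.coe_add]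
    exact (norm_add₃_le).trans (add_le_add (add_le_add h1 h2) h3)
  · set M := dualModulus φ (f₁ + f₂ : C(X, ℝ≥0))
    have key : ∀ g₁ g₂ : C(X, ℂ), (∀ x, ‖g₁ x‖ ≤ f₁ x) → (∀ x, ‖g₂ x‖ ≤ f₂ x) →
        ‖φ g₁‖₊ + ‖φ g₂‖₊ ≤ M := fun g₁ g₂ h₁ h₂ => by
      obtain ⟨c₁, hc₁, e₁⟩ := exists_phase (φ g₁)
      obtain ⟨c₂, hc₂, e₂⟩ := exists_phase (φ g₂)
      have h : ‖φ (c₁ • g₁ + c₂ • g₂)‖₊ ≤ M := nnnorm_le_dualModulus φ (f₁ + f₂) fun x => by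
        refine (norm_add_le _ _).trans ?_
        rw [ContinuousMap.add_apply, NNReal.coe_add]
        refine add_le_add (le_trans ?_ (h₁ x)) (le_trans ?_ (h₂ x)) <;>
        · rw [ContinuousMap.smul_apply, norm_smul]
          exact mul_le_of_le_one_left (norm_nonneg _) ‹_›
      refine le_trans (le_of_eq ?_) h
      rw [map_add, map_smul, map_smul, smul_eq_mul, smul_eq_mul, e₁, e₂, ← NNReal.coe_inj]
      rw [coe_nnnorm, ← Complex.ofReal_add, Complex.norm_real, Real.norm_of_nonneg (by positivity)]
      simp
    have hz₁ : ∀ x, ‖(0 : C(X, ℂ)) x‖ ≤ f₁ x := fun x => by simp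
    have h₂ : ∀ g₂ : C(X, ℂ), (∀ x, ‖g₂ x‖ ≤ f₂ x) → dualModulus φ f₁ + ‖φ g₂‖₊ ≤ M :=
      fun g₂ hg₂ => by
        have hM : ‖φ g₂‖₊ ≤ M := le_trans le_add_self (key 0 g₂ hz₁ hg₂)
        have := dualModulus_le φ f₁ (C := M - ‖φ g₂‖₊)
          fun g₁ hg₁ => le_tsub_of_add_le_right (key g₁ g₂ hg₁ hg₂)
        exact (le_tsub_iff_right hM).1 this
    have hM : dualModulus φ f₁ ≤ M := le_trans le_self_add (h₂ 0 fun x => by simp)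
    have := dualModulus_le φ f₂ (C := M - dualModulus φ f₁)
      fun g₂ hg₂ => le_tsub_of_add_le_left (h₂ g₂ hg₂)
    exact (le_tsub_iff_left hM).1 this

theorem le_dualModulus_smul (c : ℝ≥0) (f : C(X, ℝ≥0)) :
    c * dualModulus φ f ≤ dualModulus φ (c • f : C(X, ℝ≥0)) := by
  rcases eq_or_ne c 0 with rfl | hc
  · simp
  · rw [← le_div_iff₀' (pos_iff_ne_zero.2 hc)]
    refine dualModulus_le φ f fun g hg => ?_
    rw [le_div_iff₀' (pos_iff_ne_zero.2 hc)]
    refine le_trans (le_of_eq ?_)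
      (nnnorm_le_dualModulus φ (c • f) (g := ((c : ℝ) : ℂ) • g) fun x => ?_)
    · rw [map_smul, nnnorm_smul, Complex.nnnorm_real, NNReal.nnnorm_eq]
    · rw [ContinuousMap.smul_apply, norm_smul, Complex.norm_real, NNReal.norm_eq]
      exact mul_le_mul_of_nonneg_left (hg x) c.2

theorem dualModulus_smul (c : ℝ≥0) (f : C(X, ℝ≥0)) :
    dualModulus φ (c • f : C(X, ℝ≥0)) = c * dualModulus φ f := by
  refine le_antisymm ?_ (le_dualModulus_smul φ c f)
  rcases eq_or_ne c 0 with rfl | hc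
  · refine dualModulus_le φ _ fun g hg => ?_
    have : g = 0 := by
      ext x
      simpa using hg x
    simp [this]
  · have := le_dualModulus_smul φ c⁻¹ (c • f)
    rw [smul_smul, inv_mul_cancel₀ hc, one_smul] at this
    rwa [inv_mul_le_iff₀ (pos_iff_ne_zero.2 hc)] at this

/-- The modulus of a bounded functional, as a positive functional on nonnegative functions. -/
def dualModulusLinear : CompactlySupportedContinuousMap X ℝ≥0 →ₗ[ℝ≥0] ℝ≥0 where
  toFun f := dualModulus φ f
  map_add' f g := dualModulus_add φ f g
  map_smul' c f := dualModulus_smul φ c f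

variable [MeasurableSpace X] [BorelSpace X]

/-- The measure representing the modulus of a bounded functional. -/
def modulusMeasure : Measure X := NNRealRMK.rieszMeasure (dualModulusLinear φ)

instance regular_modulusMeasure : (modulusMeasure φ).Regular :=
  NNRealRMK.rieszMeasure_regular _

theorem integral_modulusMeasure (f : C(X, ℝ≥0)) :
    ∫ x, (f x : ℝ) ∂modulusMeasure φ = dualModulus φ f :=
  NNRealRMK.integral_rieszMeasure (dualModulusLinear φ)
    (CompactlySupportedContinuousMap.continuousMapEquiv f)

instance isFiniteMeasure_modulusMeasure : IsFiniteMeasure (modulusMeasure φ) :=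
  CompactSpace.isFiniteMeasure

theorem modulusMeasure_univ_le : (modulusMeasure φ).real Set.univ ≤ ‖φ‖ := by
  have h := integral_modulusMeasure φ (ContinuousMap.const X 1)
  simp only [ContinuousMap.const_apply, NNReal.coe_one, integral_const, smul_eq_mul, mul_one] at h
  rw [h, ← coe_nnnorm, NNReal.coe_le_coe]
  refine dualModulus_le φ _ fun g hg => (φ.le_opNNNorm g).trans (mul_le_of_le_one_right' ?_)
  exact (ContinuousMap.norm_le _ zero_le_one).2 hg

theorem norm_le_integral_modulusMeasure (g : C(X, ℂ)) :
    ‖φ g‖ ≤ ∫ x, ‖g x‖ ∂modulusMeasure φ := by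
  let f : C(X, ℝ≥0) := ⟨fun x => ‖g x‖₊, by fun_prop⟩
  rw [← coe_nnnorm]
  refine le_trans (NNReal.coe_le_coe.2 (nnnorm_le_dualModulus φ f fun x => le_rfl))
    (integral_modulusMeasure φ f).ge

theorem integrable_continuous_mul {ρ : Measure X} {H : X → ℂ} (hH : Integrable H ρ)
    (f : C(X, ℂ)) : Integrable (fun x => f x * H x) ρ :=
  hH.bdd_mul f.continuous.aestronglyMeasurable (c := ‖f‖)
    (Filter.Eventually.of_forall f.norm_coe_le_norm)

/-- Functionals on `C(X)` given by a density `H` have norm at least `∫ ‖H‖ dρ`. -/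
theorem integral_norm_le_of_forall_integral_le {ρ : Measure X} [IsFiniteMeasure ρ]
    [ρ.WeaklyRegular] {H : X → ℂ} (hH : Integrable H ρ) {C : ℝ}
    (h : ∀ f : C(X, ℂ), ‖f‖ ≤ 1 → ‖∫ x, f x * H x ∂ρ‖ ≤ C) : ∫ x, ‖H x‖ ∂ρ ≤ C := by
  refine le_of_forall_pos_le_add fun ε hε => ?_
  obtain ⟨g, hg⟩ : ∃ g : C(X, ℂ), ∫ x, ‖H x - g x‖ ∂ρ ≤ ε / 3 := by
    obtain ⟨g, hg, -⟩ := hH.exists_boundedContinuous_integral_sub_le (ε := ε / 3) (by positivity)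
    exact ⟨g.toContinuousMap, hg⟩
  have hgi : Integrable g ρ :=
    g.continuous.integrable_of_hasCompactSupport (HasCompactSupport.of_compactSpace g)
  have hHg : Integrable (fun x => H x - g x) ρ := hH.sub hgi
  let δ : ℝ := ε / (3 * (ρ.real Set.univ + 1))
  have hδ : 0 < δ := by positivity
  have hpos : ∀ x, 0 < ‖g x‖ + δ := fun x => by positivity
  -- A continuous substitute for the conjugate phase of `g`. It loses at most `δ` pointwise, thus `ε
  -- / 3` in the integral; the other two thirds pay for replacing `H` by `g` twice.
  let f : C(X, ℂ) := ⟨fun x => conj (g x) / ((‖g x‖ + δ : ℝ) : ℂ), by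
    refine Continuous.div (by fun_prop) (by fun_prop) fun x => ?_
    exact_mod_cast (hpos x).ne'⟩
  have hf : ‖f‖ ≤ 1 := (ContinuousMap.norm_le _ zero_le_one).2 fun x => by
    simp only [f, ContinuousMap.coe_mk]
    rw [norm_div, RCLike.norm_conj, Complex.norm_real, Real.norm_of_nonneg (hpos x).le,
      div_le_one (hpos x)]
    linarith
  have hfg : ∀ x, ‖g x‖ - δ ≤ (f x * g x).re := fun x => by
    have h1 : f x * g x = ((‖g x‖ ^ 2 / (‖g x‖ + δ) : ℝ) : ℂ) := by
      simp only [f, ContinuousMap.coe_mk]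
      rw [div_mul_eq_mul_div, Complex.conj_mul']
      push_cast
      rfl
    rw [h1, Complex.ofReal_re, le_div_iff₀ (hpos x)]
    nlinarith [norm_nonneg (g x)]
  have hi := integrable_continuous_mul hgi f
  have e1 : ∫ x, ‖g x‖ ∂ρ - δ * ρ.real Set.univ ≤ ‖∫ x, f x * g x ∂ρ‖ := by
    refine le_trans ?_ (Complex.re_le_norm _)
    have e : (∫ x, f x * g x ∂ρ).re = ∫ x, (f x * g x).re ∂ρ :=
      (integral_re (𝕜 := ℂ) hi).symm
    rw [e, show δ * ρ.real Set.univ = ∫ x, δ ∂ρ by simp [mul_comm],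
      ← integral_sub hgi.norm (integrable_const _)]
    exact integral_mono (hgi.norm.sub (integrable_const _)) hi.re hfg
  have e2 : ‖∫ x, f x * g x ∂ρ‖ ≤ C + ε / 3 := by
    have : ∫ x, f x * g x ∂ρ = ∫ x, f x * H x ∂ρ - ∫ x, f x * (H x - g x) ∂ρ := by
      rw [← integral_sub (integrable_continuous_mul hH f)
        (integrable_continuous_mul hHg f)]
      refine integral_congr_ae (Filter.Eventually.of_forall fun x => ?_)
      simp only
      ring
    rw [this]
    refine (norm_sub_le _ _).trans (add_le_add (h f hf) ?_)
    refine (norm_integral_le_integral_norm _).trans (le_trans ?_ hg)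
    refine integral_mono (integrable_continuous_mul hHg f).norm hHg.norm
      fun x => ?_
    simp only [norm_mul]
    exact mul_le_of_le_one_left (norm_nonneg _) ((f.norm_coe_le_norm x).trans hf)
  have e3 : ∫ x, ‖H x‖ ∂ρ ≤ ∫ x, ‖g x‖ ∂ρ + ε / 3 := by
    refine le_trans ?_ (add_le_add_right hg _)
    rw [← integral_add hgi.norm hHg.norm]
    refine integral_mono hH.norm (hgi.norm.add hHg.norm) fun x => ?_
    simpa using norm_add_le (g x) (H x - g x)
  have e4 : δ * ρ.real Set.univ ≤ ε / 3 := by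
    have : 0 ≤ ρ.real Set.univ := measureReal_nonneg
    simp only [δ]
    rw [div_mul_eq_mul_div, div_le_div_iff₀ (by positivity) (by positivity)]
    nlinarith
  linarith

/-- The modulus measure is finite, so the bound of $\varphi$ by the $L^1$ norm is also a bound by
the $L^2$ norm. The functional extends to the Hilbert space $L^2$, where it is an inner product. -/
theorem exists_memLp_density : ∃ h : X → ℂ, MemLp h 2 (modulusMeasure φ) ∧
    ∀ f : C(X, ℂ), φ f = ∫ x, f x * h x ∂modulusMeasure φ := by
  set ρ := modulusMeasure φ
  let e : C(X, ℂ) →L[ℂ] Lp ℂ 2 ρ := ContinuousMap.toLp 2 ρ ℂ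
  have he : DenseRange (e : C(X, ℂ) →ₗ[ℂ] Lp ℂ 2 ρ) :=
    ContinuousMap.toLp_denseRange ℂ ρ ℂ ENNReal.ofNat_ne_top
  have hbound : ∃ C, ∀ f : C(X, ℂ), ‖φ f‖ ≤ C * ‖(e : C(X, ℂ) →ₗ[ℂ] Lp ℂ 2 ρ) f‖ := by
    refine ⟨(ρ Set.univ ^ (1 / (1 : ENNReal).toReal - 1 / (2 : ENNReal).toReal)).toReal,
      fun f => (norm_le_integral_modulusMeasure φ f).trans ?_⟩
    have hf : AEStronglyMeasurable f ρ := f.continuous.aestronglyMeasurable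
    have h2 := eLpNorm_le_eLpNorm_mul_rpow_measure_univ (p := 1) (q := 2) (by norm_num) hf
    have hm : MemLp f 2 ρ := MemLp.of_bound hf ‖f‖ (Filter.Eventually.of_forall f.norm_coe_le_norm)
    have hfin : ρ Set.univ ^ (1 / (1 : ENNReal).toReal - 1 / (2 : ENNReal).toReal) ≠ ⊤ :=
      ENNReal.rpow_ne_top_of_nonneg (by norm_num) (measure_ne_top _ _)
    have h3 := ENNReal.toReal_mono (ENNReal.mul_ne_top hm.eLpNorm_ne_top hfin) h2
    rw [ENNReal.toReal_mul, mul_comm] at h3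
    have h4 : ‖e f‖ = (eLpNorm f 2 ρ).toReal := by
      rw [Lp.norm_def]
      exact congrArg _ (eLpNorm_congr_ae (ContinuousMap.coeFn_toLp ρ f))
    have h5 : (eLpNorm f 1 ρ).toReal = ∫ x, ‖f x‖ ∂ρ := by
      rw [eLpNorm_one_eq_lintegral_enorm, integral_norm_eq_lintegral_enorm hf]
    rw [h5] at h3
    exact h3.trans_eq (congrArg _ h4.symm)
  let Φ : StrongDual ℂ (Lp ℂ 2 ρ) :=
    (φ : C(X, ℂ) →ₗ[ℂ] ℂ).extendOfNorm (e : C(X, ℂ) →ₗ[ℂ] Lp ℂ 2 ρ)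
  have hΦ : ∀ f, Φ (e f) = φ f := LinearMap.extendOfNorm_eq he hbound
  let v := (InnerProductSpace.toDual ℂ (Lp ℂ 2 ρ)).symm Φ
  refine ⟨fun x => conj (v x), (Lp.memLp v).star, fun f => ?_⟩
  rw [← hΦ, ← InnerProductSpace.toDual_symm_apply, L2.inner_def]
  refine integral_congr_ae ((ContinuousMap.coeFn_toLp (𝕜 := ℂ) (p := 2) ρ f).mono fun x hx => ?_)
  change inner ℂ (v x) (e f x) = _
  rw [RCLike.inner_apply, hx]

/-- **Riesz representation theorem** for bounded functionals on `C(X)`: the functional is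
integration against a unimodular density with respect to a finite regular measure whose total mass
is the norm of the functional. -/
theorem exists_unimodular_density : ∃ h : X → ℂ, Integrable h (modulusMeasure φ) ∧
    (∀ᵐ x ∂modulusMeasure φ, ‖h x‖ = 1) ∧ (∀ f : C(X, ℂ), φ f = ∫ x, f x * h x ∂modulusMeasure φ) ∧
    (modulusMeasure φ).real Set.univ = ‖φ‖ := by
  obtain ⟨h, hh2, hφ⟩ := exists_memLp_density φ
  have hnorm := norm_le_integral_modulusMeasure φ
  have huniv := modulusMeasure_univ_le φ
  set ρ := modulusMeasure φ
  have hh : Integrable h ρ := hh2.integrable (by norm_num)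
  have hnormle : ‖φ‖ ≤ ∫ x, ‖h x‖ ∂ρ := by
    refine φ.opNorm_le_bound (integral_nonneg fun _ => norm_nonneg _) fun f => ?_
    rw [hφ, mul_comm, ← integral_const_mul]
    refine (norm_integral_le_integral_norm _).trans (integral_mono
      (integrable_continuous_mul hh f).norm (hh.norm.const_mul _) fun x => ?_)
    simp only [norm_mul]
    exact mul_le_mul_of_nonneg_right (f.norm_coe_le_norm x) (norm_nonneg _)
  have hsub : Integrable (fun x => ‖h x‖ - 1) ρ := hh.norm.sub (integrable_const 1)
  have hint : ∀ f : C(X, ℝ), Integrable (fun x => f x * (‖h x‖ - 1)) ρ := fun f =>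
    hsub.bdd_mul f.continuous.aestronglyMeasurable (c := ‖f‖)
      (Filter.Eventually.of_forall f.norm_coe_le_norm)
  have hcont : ∀ f : C(X, ℝ), Integrable f ρ := fun f =>
    f.continuous.integrable_of_hasCompactSupport (HasCompactSupport.of_compactSpace f)
  -- The functional $f\mapsto\int f(|h|-1)\,d\rho$ is nonpositive on nonnegative functions, because
  -- $|\varphi(gf)|\le\int f\,d\rho$ for $|g|\le 1$; at the constant $1$ it is nonnegative, because
  -- $\rho(X)\le\|\varphi\|\le\int|h|\,d\rho$. Hence it is zero and $|h|=1$ almost everywhere.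
  have hle : ∀ f : C(X, ℝ), (∀ x, 0 ≤ f x) → ∫ x, f x * (‖h x‖ - 1) ∂ρ ≤ 0 := fun f hf => by
    let f' : C(X, ℂ) := ⟨fun x => (f x : ℂ), by fun_prop⟩
    have h1 : ∫ x, ‖f' x * h x‖ ∂ρ ≤ ∫ x, f x ∂ρ := by
      refine integral_norm_le_of_forall_integral_le (integrable_continuous_mul hh f') fun g hg => ?_
      have : ∫ x, g x * (f' x * h x) ∂ρ = φ (g * f') := by
        rw [hφ]
        simp only [ContinuousMap.mul_apply, mul_assoc]
      rw [this]
      refine (hnorm _).trans (integral_mono ?_ (hcont f) fun x => ?_)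
      · exact ((g * f').continuous.integrable_of_hasCompactSupport
          (HasCompactSupport.of_compactSpace _)).norm
      · simp only [ContinuousMap.mul_apply, norm_mul]
        have : ‖f' x‖ = f x := by
          simp only [f', ContinuousMap.coe_mk, Complex.norm_real, Real.norm_of_nonneg (hf x)]
        rw [this]
        exact mul_le_of_le_one_left (hf x) ((g.norm_coe_le_norm x).trans hg)
    have h2 : ∫ x, f x * (‖h x‖ - 1) ∂ρ = ∫ x, ‖f' x * h x‖ ∂ρ - ∫ x, f x ∂ρ := by
      rw [← integral_sub (integrable_continuous_mul hh f').norm (hcont f)]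
      refine integral_congr_ae (Filter.Eventually.of_forall fun x => ?_)
      simp only [f', norm_mul, ContinuousMap.coe_mk, Complex.norm_real, Real.norm_of_nonneg (hf x)]
      ring
    rw [h2]
    exact sub_nonpos.2 h1
  have htot : 0 ≤ ∫ x, (‖h x‖ - 1) ∂ρ := by
    rw [integral_sub hh.norm (integrable_const 1)]
    simp only [integral_const, smul_eq_mul, mul_one]
    linarith
  -- Apply `hle` to $1+f$; the constant contributes a nonnegative amount by `htot`. When $|f|\le 1$
  -- this covers both $f$ and $-f$.
  have hle' : ∀ f : C(X, ℝ), (∀ x, -1 ≤ f x) → ∫ x, f x * (‖h x‖ - 1) ∂ρ ≤ 0 := fun f hf => by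
    have h1 := hle (1 + f) fun x => by
      rw [ContinuousMap.add_apply, ContinuousMap.one_apply]
      linarith [hf x]
    simp only [ContinuousMap.add_apply, ContinuousMap.one_apply, add_mul, one_mul] at h1
    rw [integral_add hsub (hint f)] at h1
    linarith
  have hzero : ∀ f : C(X, ℝ), (∀ x, |f x| ≤ 1) → ∫ x, f x * (‖h x‖ - 1) ∂ρ = 0 := fun f hf => by
    refine le_antisymm (hle' f fun x => (abs_le.1 (hf x)).1) ?_
    have h1 := hle' (-f) fun x => neg_le_neg (abs_le.1 (hf x)).2
    simp only [ContinuousMap.neg_apply, neg_mul, integral_neg] at h1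
    linarith
  have hone : ∫ x, ‖((‖h x‖ - 1 : ℝ) : ℂ)‖ ∂ρ ≤ 0 := by
    refine integral_norm_le_of_forall_integral_le hsub.ofReal fun g hg => ?_
    have hi := integrable_continuous_mul (hsub.ofReal (𝕜 := ℂ)) g
    have hgx : ∀ x, ‖g x‖ ≤ 1 := fun x => (g.norm_coe_le_norm x).trans hg
    refine (norm_eq_zero.2 (Complex.ext ?_ ?_)).le
    · refine (integral_re (𝕜 := ℂ) hi).symm.trans ?_
      refine Eq.trans ?_ (hzero ⟨fun x => (g x).re, by fun_prop⟩
        fun x => (Complex.abs_re_le_norm _).trans (hgx x))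
      simp
    · refine (integral_im (𝕜 := ℂ) hi).symm.trans ?_
      refine Eq.trans ?_ (hzero ⟨fun x => (g x).im, by fun_prop⟩
        fun x => (Complex.abs_im_le_norm _).trans (hgx x))
      simp
  have hae : ∀ᵐ x ∂ρ, ‖h x‖ = 1 := by
    have h0 := (integral_eq_zero_iff_of_nonneg (fun x => norm_nonneg _)
      (hsub.ofReal (𝕜 := ℂ)).norm).1 (le_antisymm hone (integral_nonneg fun x => norm_nonneg _))
    filter_upwards [h0] with x hx
    have : ((‖h x‖ - 1 : ℝ) : ℂ) = 0 := norm_eq_zero.1 hx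
    have : ‖h x‖ - 1 = 0 := by exact_mod_cast this
    linarith
  refine ⟨h, hh, hae, hφ, le_antisymm huniv (hnormle.trans_eq ?_)⟩
  rw [integral_congr_ae hae]
  simp

end ComplexRiesz

/-! ### Complex measures, their densities and their functionals on $C(X)$. -/

section ComplexMeasures

variable {X : Type*} [TopologicalSpace X] [CompactSpace X] [T2Space X] [MeasurableSpace X]
  [BorelSpace X]

theorem exists_density_of_absolutelyContinuous (μ : ComplexMeasure X) (ρ : Measure X)
    [IsFiniteMeasure ρ] (hμ : μ.variation ≪ ρ) :
    ∃ H : X → ℂ, Integrable H ρ ∧ μ = ρ.withDensityᵥ H := by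
  have hac : μ ≪ᵥ ρ.toENNRealVectorMeasure := by
    refine VectorMeasure.AbsolutelyContinuous.mk fun s hs h0 => ?_
    rw [Measure.toENNRealVectorMeasure_apply_measurable hs] at h0
    have h1 := VectorMeasure.enorm_measure_le_variation μ s
    rw [hμ h0] at h1
    exact enorm_eq_zero.1 (le_antisymm h1 zero_le)
  obtain ⟨hre, him⟩ := (ComplexMeasure.absolutelyContinuous_ennreal_iff μ _).1 hac
  have h1 := (SignedMeasure.absolutelyContinuous_iff_withDensityᵥ_rnDeriv_eq _ _).1 hre
  have h2 := (SignedMeasure.absolutelyContinuous_iff_withDensityᵥ_rnDeriv_eq _ _).1 him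
  have i1 : Integrable ((ComplexMeasure.re μ).rnDeriv ρ) ρ := SignedMeasure.integrable_rnDeriv _ _
  have i2 : Integrable ((ComplexMeasure.im μ).rnDeriv ρ) ρ := SignedMeasure.integrable_rnDeriv _ _
  have j1 : Integrable (fun x => ((ComplexMeasure.re μ).rnDeriv ρ x : ℂ)) ρ := i1.ofReal
  have j2 : Integrable (fun x => ((ComplexMeasure.im μ).rnDeriv ρ x : ℂ) * Complex.I) ρ :=
    (i2.ofReal (𝕜 := ℂ)).mul_const _
  have hi : Integrable (fun x => ((ComplexMeasure.re μ).rnDeriv ρ x : ℂ) +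
      ((ComplexMeasure.im μ).rnDeriv ρ x : ℂ) * Complex.I) ρ :=
    j1.add j2
  refine ⟨_, hi, ?_⟩
  ext s hs
  rw [withDensityᵥ_apply hi hs, integral_add j1.integrableOn j2.integrableOn, integral_mul_const]
  have e1 : ((μ s).re : ℝ) = ∫ x in s, (ComplexMeasure.re μ).rnDeriv ρ x ∂ρ := by
    rw [← withDensityᵥ_apply i1 hs, h1]
    rfl
  have e2 : ((μ s).im : ℝ) = ∫ x in s, (ComplexMeasure.im μ).rnDeriv ρ x ∂ρ := by
    rw [← withDensityᵥ_apply i2 hs, h2]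
    rfl
  rw [← Complex.re_add_im (μ s), e1, e2]
  congr 1
  · exact integral_complex_ofReal.symm
  · congr 1
    exact integral_complex_ofReal.symm


theorem integrable_withDensity_enorm_iff {Y : Type*} [MeasurableSpace Y] {ρ : Measure Y}
    {H : Y → ℂ} (hH : Integrable H ρ) {f : Y → ℂ} :
    Integrable f (ρ.withDensity fun x => ‖H x‖ₑ) ↔ Integrable (fun x => ‖H x‖ • f x) ρ := by
  have h := integrable_withDensity_iff_integrable_smul₀ (μ := ρ) (f := fun x => ‖H x‖₊) (g := f)
    hH.aestronglyMeasurable.aemeasurable.nnnorm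
  exact h

/-- Both sides are continuous on $L^1(\nu)$, where $\nu=|H|\rho$ is the variation: $f\mapsto fH$
preserves the $L^1$ norm from $\nu$ to $\rho$. It remains to compare them on indicators. -/
theorem integral_withDensityᵥ {Y : Type*} [MeasurableSpace Y] {ρ : Measure Y} [IsFiniteMeasure ρ]
    {H : Y → ℂ} (hH : Integrable H ρ) {f : Y → ℂ}
    (hf : Integrable f (ρ.withDensity fun x => ‖H x‖ₑ)) :
    VectorMeasure.integral (ρ.withDensityᵥ H) f (ContinuousLinearMap.mul ℝ ℂ) =
      ∫ x, f x * H x ∂ρ := by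
  have hvar := Measure.variation_withDensityᵥ hH
  set ν := ρ.withDensity fun x => ‖H x‖ₑ with hν
  have hfin : IsFiniteMeasure ν := isFiniteMeasure_withDensity hH.2.ne
  have hHm : AEMeasurable H ρ := hH.aestronglyMeasurable.aemeasurable
  -- The measure `ν` does not see the zeros of `H`, but there the products vanish anyway.
  have hcongr : ∀ f g : Y → ℂ, f =ᵐ[ν] g →
      (fun x => f x * H x) =ᵐ[ρ] fun x => g x * H x := fun f g hfg => by
    filter_upwards [(ae_withDensity_iff' hHm.enorm).1 hfg] with x hx
    rcases eq_or_ne (H x) 0 with h0 | h0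
    · rw [h0, mul_zero, mul_zero]
    · rw [hx (enorm_ne_zero.2 h0)]
  have hmul : ∀ g : Y → ℂ, Integrable g ν → Integrable (fun x => g x * H x) ρ := fun g hg => by
    have hm : AEStronglyMeasurable (fun x => g x * H x) ρ :=
      (hg.1.stronglyMeasurable_mk.aestronglyMeasurable.mul hH.1).congr
        (hcongr _ _ hg.1.ae_eq_mk).symm
    refine (integrable_norm_iff hm).1
      (((integrable_withDensity_enorm_iff hH).1 hg).norm.congr (Filter.Eventually.of_forall ?_))
    intro x
    simp [mul_comm]
  have hnorm : ∀ g : Y → ℂ, ∫ x, ‖g x * H x‖ ∂ρ = ∫ x, ‖g x‖ ∂ν := fun g => by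
    refine Eq.trans ?_ (integral_withDensity_eq_integral_smul₀ hHm.nnnorm (fun x => ‖g x‖)).symm
    refine integral_congr_ae (Filter.Eventually.of_forall fun x => ?_)
    simp [mul_comm, NNReal.smul_def]
  refine Integrable.induction (μ := ν) (fun f => VectorMeasure.integral (ρ.withDensityᵥ H) f
    (ContinuousLinearMap.mul ℝ ℂ) = ∫ x, f x * H x ∂ρ) ?_ ?_ ?_ ?_ hf
  · intro c s hs _
    have : IsFiniteMeasure (ρ.withDensityᵥ H).variation := hvar ▸ hfin
    rw [VectorMeasure.integral_indicator hs, VectorMeasure.setIntegral_const,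
      withDensityᵥ_apply hH hs, ContinuousLinearMap.mul_apply', ← integral_const_mul,
      ← integral_indicator hs]
    congr 1 with x
    by_cases hx : x ∈ s <;> simp [hx]
  · intro f g _ hf hg hPf hPg
    rw [← hvar] at hf hg
    have h := VectorMeasure.integral_fun_add (B := ContinuousLinearMap.mul ℝ ℂ) hf hg
    rw [hvar] at hf hg
    simp only [Pi.add_apply, add_mul]
    rw [integral_add (hmul f hf) (hmul g hg), ← hPf, ← hPg]
    exact h
  · refine isClosed_eq ?_ ?_
    · have := VectorMeasure.continuous_integral (μ := ρ.withDensityᵥ H)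
        (B := ContinuousLinearMap.mul ℝ ℂ)
      rw [hvar] at this
      exact this
    · refine LipschitzWith.continuous (K := 1) (LipschitzWith.of_dist_le_mul fun f g => ?_)
      have hf := L1.integrable_coeFn f
      have hg := L1.integrable_coeFn g
      rw [NNReal.coe_one, one_mul, dist_eq_norm, dist_eq_norm, ← integral_sub (hmul _ hf) (hmul _ hg),
        L1.norm_eq_integral_norm, ← hnorm]
      refine (norm_integral_le_integral_norm _).trans_eq (integral_congr_ae ?_)
      filter_upwards [hcongr _ _ (Lp.coeFn_sub f g)] with x hx
      rw [hx, Pi.sub_apply, sub_mul]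
  · intro f g hfg hf hPf
    rw [← integral_congr_ae (hcongr f g hfg), ← hPf]
    rw [← hvar] at hfg
    exact (VectorMeasure.integral_congr_ae hfg).symm

theorem cintegral_withDensityᵥ {ρ : Measure X} [IsFiniteMeasure ρ] {H : X → ℂ}
    (hH : Integrable H ρ) (f : C(X, ℂ)) :
    cintegral (ρ.withDensityᵥ H) f = ∫ x, f x * H x ∂ρ := by
  have := isFiniteMeasure_withDensity (μ := ρ) (f := fun x => ‖H x‖ₑ) hH.2.ne
  exact integral_withDensityᵥ hH
    (f.continuous.integrable_of_hasCompactSupport (HasCompactSupport.of_compactSpace f))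

/-- A complex measure which is absolutely continuous with respect to a finite regular measure is
determined by its integrals against continuous functions. -/
theorem eq_zero_of_forall_cintegral_eq_zero {μ : ComplexMeasure X} (ρ : Measure X)
    [IsFiniteMeasure ρ] [ρ.WeaklyRegular] (hμ : μ.variation ≪ ρ)
    (h : ∀ f : C(X, ℂ), cintegral μ f = 0) : μ = 0 := by
  obtain ⟨H, hH, rfl⟩ := exists_density_of_absolutelyContinuous μ ρ hμ
  have h0 : ∫ x, ‖H x‖ ∂ρ ≤ 0 := integral_norm_le_of_forall_integral_le hH fun f _ => by
    rw [← cintegral_withDensityᵥ hH, h, norm_zero]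
  have h1 := (integral_eq_zero_iff_of_nonneg (fun x => norm_nonneg _) hH.norm).1
    (le_antisymm h0 (integral_nonneg fun x => norm_nonneg _))
  have h2 : H =ᵐ[ρ] 0 := h1.mono fun x hx => norm_eq_zero.1 hx
  rw [WithDensityᵥEq.congr_ae h2, withDensityᵥ_zero]

theorem integrable_continuousMap_of_isFiniteMeasure (ρ : Measure X) [IsFiniteMeasure ρ]
    (f : C(X, ℂ)) : Integrable f ρ :=
  f.continuous.integrable_of_hasCompactSupport (HasCompactSupport.of_compactSpace f)

theorem cintegral_add {μ ν : ComplexMeasure X} [IsFiniteMeasure μ.variation]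
    [IsFiniteMeasure ν.variation] (f : C(X, ℂ)) :
    cintegral (μ + ν) f = cintegral μ f + cintegral ν f :=
  VectorMeasure.integral_add_vectorMeasure (integrable_continuousMap_of_isFiniteMeasure _ f)
    (integrable_continuousMap_of_isFiniteMeasure _ f)

theorem cintegral_smul {μ : ComplexMeasure X} [IsFiniteMeasure μ.variation] (c : ℂ) (f : C(X, ℂ)) :
    cintegral (c • μ) f = c * cintegral μ f := by
  obtain ⟨H, hH, hμ⟩ := exists_density_of_absolutelyContinuous μ μ.variation .rfl
  rw [hμ, ← withDensityᵥ_smul, ← hμ, cintegral_withDensityᵥ (hH.smul c),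
    show cintegral μ f = _ from (congrArg (fun ν => cintegral ν f) hμ).trans
      (cintegral_withDensityᵥ hH f), ← integral_const_mul]
  simp only [Pi.smul_apply, smul_eq_mul, mul_left_comm]

/-- Regularity is asked of a dominating `ρ`, so that it need not be proved for the variation of a
sum or difference. In the applications `ρ` is a sum of multiples of regular variations. -/
theorem eq_of_forall_cintegral_eq {μ ν : ComplexMeasure X} (ρ : Measure X) [IsFiniteMeasure ρ]
    [ρ.WeaklyRegular] (hμ : μ.variation ≤ ρ) (hν : ν.variation ≤ ρ)
    (h : ∀ f : C(X, ℂ), cintegral μ f = cintegral ν f) : μ = ν := by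
  have hμ' : IsFiniteMeasure μ.variation := isFiniteMeasure_of_le ρ hμ
  have hν' : IsFiniteMeasure ν.variation := isFiniteMeasure_of_le ρ hν
  refine sub_eq_zero.1 (eq_zero_of_forall_cintegral_eq_zero ρ ?_ fun f => ?_)
  · exact (Measure.absolutelyContinuous_of_le VectorMeasure.variation_sub_le).trans
      (Measure.AbsolutelyContinuous.add_left (Measure.absolutelyContinuous_of_le hμ)
        (Measure.absolutelyContinuous_of_le hν))
  · exact (VectorMeasure.integral_sub_vectorMeasure
      (integrable_continuousMap_of_isFiniteMeasure _ f)
      (integrable_continuousMap_of_isFiniteMeasure _ f)).trans (sub_eq_zero.2 (h f))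

/-- Every functional on `C(X)` is represented by a complex measure whose variation is the modulus
measure of the functional. -/
theorem exists_complexMeasure (φ : StrongDual ℂ C(X, ℂ)) :
    ∃ μ : ComplexMeasure X, μ.variation = modulusMeasure φ ∧ ∀ f : C(X, ℂ), φ f = cintegral μ f := by
  obtain ⟨h, hi, hone, hφ, -⟩ := exists_unimodular_density φ
  refine ⟨(modulusMeasure φ).withDensityᵥ h, ?_, fun f => ?_⟩
  · rw [Measure.variation_withDensityᵥ hi,
      withDensity_congr_ae (g := 1) (hone.mono fun x hx => ?_), withDensity_one]
    rw [← ofReal_norm, hx, ENNReal.ofReal_one, Pi.one_apply]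
  · rw [cintegral_withDensityᵥ hi, hφ]

/-- The complex measure representing a functional on `C(X)`. -/
def representingMeasure (φ : StrongDual ℂ C(X, ℂ)) : ComplexMeasure X :=
  (exists_complexMeasure φ).choose

theorem variation_representingMeasure (φ : StrongDual ℂ C(X, ℂ)) :
    (representingMeasure φ).variation = modulusMeasure φ :=
  (exists_complexMeasure φ).choose_spec.1

theorem cintegral_representingMeasure (φ : StrongDual ℂ C(X, ℂ)) (f : C(X, ℂ)) :
    cintegral (representingMeasure φ) f = φ f :=
  ((exists_complexMeasure φ).choose_spec.2 f).symm

instance regular_variation_representingMeasure (φ : StrongDual ℂ C(X, ℂ)) :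
    (representingMeasure φ).variation.Regular := by
  rw [variation_representingMeasure]
  infer_instance

instance isFiniteMeasure_variation_representingMeasure (φ : StrongDual ℂ C(X, ℂ)) :
    IsFiniteMeasure (representingMeasure φ).variation := by
  rw [variation_representingMeasure]
  infer_instance

theorem variation_representingMeasure_univ (φ : StrongDual ℂ C(X, ℂ)) :
    (representingMeasure φ).variation Set.univ = ENNReal.ofReal ‖φ‖ := by
  obtain ⟨-, -, -, -, h⟩ := exists_unimodular_density φ
  rw [variation_representingMeasure, ← h, ofReal_measureReal]

/-- The regular complex measure `μ` represents the functional `f ↦ ∫ f dμ`. -/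
theorem exists_representingMeasure_eq (μ : ComplexMeasure X) [μ.variation.Regular] :
    ∃ φ : StrongDual ℂ C(X, ℂ), representingMeasure φ = μ := by
  have : IsFiniteMeasure μ.variation := CompactSpace.isFiniteMeasure
  obtain ⟨H, hH, hμ⟩ := exists_density_of_absolutelyContinuous μ μ.variation .rfl
  let φ : StrongDual ℂ C(X, ℂ) := LinearMap.mkContinuous
    { toFun := fun f => ∫ x, f x * H x ∂μ.variation
      map_add' := fun f g => by
        simp only [ContinuousMap.add_apply, add_mul]
        exact integral_add (integrable_continuous_mul hH f) (integrable_continuous_mul hH g)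
      map_smul' := fun c f => by
        simp only [ContinuousMap.smul_apply, smul_mul_assoc]
        exact integral_smul c _ } (∫ x, ‖H x‖ ∂μ.variation) fun f => by
    rw [mul_comm, ← integral_const_mul]
    refine (norm_integral_le_integral_norm _).trans (integral_mono
      (integrable_continuous_mul hH f).norm (hH.norm.const_mul _) fun x => ?_)
    simp only [norm_mul]
    exact mul_le_mul_of_nonneg_right (f.norm_coe_le_norm x) (norm_nonneg _)
  refine ⟨φ, eq_of_forall_cintegral_eq ((representingMeasure φ).variation + μ.variation)
    (Measure.le_add_right le_rfl) (Measure.le_add_left le_rfl) fun f => ?_⟩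
  rw [cintegral_representingMeasure]
  conv_rhs => rw [hμ]
  exact (cintegral_withDensityᵥ hH f).symm

theorem representingMeasure_add (φ ψ : StrongDual ℂ C(X, ℂ)) :
    representingMeasure (φ + ψ) = representingMeasure φ + representingMeasure ψ := by
  refine eq_of_forall_cintegral_eq ((representingMeasure (φ + ψ)).variation +
    ((representingMeasure φ).variation + (representingMeasure ψ).variation))
    (Measure.le_add_right le_rfl) (Measure.le_add_left VectorMeasure.variation_add_le) fun f => ?_
  rw [cintegral_add]
  simp only [cintegral_representingMeasure, _root_.add_apply]

theorem representingMeasure_smul (c : ℂ) (φ : StrongDual ℂ C(X, ℂ)) :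
    representingMeasure (c • φ) = c • representingMeasure φ := by
  refine eq_of_forall_cintegral_eq ((representingMeasure (c • φ)).variation +
    ‖c‖₊ • (representingMeasure φ).variation)
    (Measure.le_add_right le_rfl) (Measure.le_add_left VectorMeasure.variation_smul.le) fun f => ?_
  rw [cintegral_smul]
  simp only [cintegral_representingMeasure, _root_.smul_apply, smul_eq_mul]

end ComplexMeasures

/-! ### The annihilator of $C_\Lambda(G)$ and the dual of the quotient. -/

section Annihilator

variable {G : Type*} [CommGroup G] [TopologicalSpace G] [IsTopologicalGroup G] [CompactSpace G]
  [T2Space G] [MeasurableSpace G] [BorelSpace G]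

/-- The conjugate of a character, as a continuous function. -/
def conjChar (γ : PontryaginDual G) : C(G, ℂ) := ⟨_, continuous_conj_character γ⟩

theorem conjChar_apply (γ : PontryaginDual G) (x : G) : conjChar γ x = conj (γ x : ℂ) := rfl

theorem conjChar_mul_apply (γ : PontryaginDual G) (x y : G) :
    conjChar γ (x * y) = conjChar γ x * conjChar γ y := by
  simp [conjChar_apply]

theorem integral_conjChar_eq_zero {γ : PontryaginDual G} (hγ : γ ≠ 1) :
    ∫ x, conjChar γ x ∂normHaar G = 0 := by
  obtain ⟨a, ha⟩ : ∃ a, γ a ≠ 1 := by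
    by_contra! h
    exact hγ (ContinuousMonoidHom.ext h)
  have h : ∫ x, conjChar γ x ∂normHaar G = conjChar γ a * ∫ x, conjChar γ x ∂normHaar G := by
    conv_lhs => rw [← integral_mul_left_eq_self _ a]
    rw [← integral_const_mul]
    simp only [conjChar_mul_apply]
  have h2 : conjChar γ a ≠ 1 := fun h1 => ha <| by
    rw [conjChar_apply] at h1
    have := congrArg conj h1
    rw [Complex.conj_conj, map_one] at this
    exact Circle.ext this
  have h3 : (1 - conjChar γ a) * ∫ x, conjChar γ x ∂normHaar G = 0 := by
    rw [sub_mul, one_mul, ← h, sub_self]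
  exact (mul_eq_zero.1 h3).resolve_left (sub_ne_zero.2 h2.symm)

/-- Orthogonality of characters: the coefficient of $\overline\gamma$ at $\delta$ is
$\int\overline{\delta\gamma}\,dm$, which vanishes unless $\delta=\gamma^{-1}$. -/
theorem conjChar_mem_contSpec {Λ : Set (PontryaginDual G)} {γ : PontryaginDual G} (hγ : γ ∈ Λ⁻¹) :
    conjChar γ ∈ contSpec Λ := by
  intro δ hδ
  by_cases h : δ * γ = 1
  · rwa [eq_inv_of_mul_eq_one_left h]
  · refine absurd (Eq.trans ?_ (integral_conjChar_eq_zero h)) hδ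
    refine integral_congr_ae (Filter.Eventually.of_forall fun x => ?_)
    have : (δ * γ) x = δ x * γ x := rfl
    simp only [conjChar_apply, this, Circle.coe_mul, map_mul]

/-- The substitution $x\mapsto y^{-1}x$ pulls out $\gamma(y)$, so the Fourier coefficient of the
orbit of $f$ under translation is $\hat f(\gamma)\gamma$. The character $\gamma$ appears as the
conjugate of $\gamma^{-1}$. -/
theorem integral_conj_smul_shift (f : C(G, ℂ)) (γ : PontryaginDual G) :
    ∫ x, conj (γ x : ℂ) • shift f x ∂normHaar G = fourierCoef f γ • conjChar γ⁻¹ := by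
  have hint : Integrable (fun x => conj (γ x : ℂ) • shift f x) (normHaar G) :=
    integrable_of_continuous ((continuous_conj_character γ).smul (shift f).continuous)
  ext y
  have h := (ContinuousMap.evalCLM ℂ y).integral_comp_comm hint
  refine h.symm.trans ?_
  rw [← integral_mul_left_eq_self _ y⁻¹, ContinuousMap.smul_apply, smul_eq_mul, fourierCoef,
    ← integral_mul_const]
  refine integral_congr_ae (Filter.Eventually.of_forall fun x => ?_)
  have h2 := conjChar_mul_apply γ y⁻¹ x
  have h3 : conjChar γ⁻¹ y = conjChar γ y⁻¹ := by
    have : (γ⁻¹ : PontryaginDual G) y = (γ y)⁻¹ := rfl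
    rw [conjChar_apply, conjChar_apply, map_inv, this]
  have h4 : y⁻¹ * x * y = x := by rw [mul_right_comm, inv_mul_cancel, one_mul]
  change conjChar γ (y⁻¹ * x) * f (y⁻¹ * x * y) = conjChar γ x * f x * conjChar γ⁻¹ y
  rw [h2, h3, h4]
  ring

/-- A functional on `C(G)` annihilates `C_Λ(G)` as soon as it annihilates the conjugates of all
characters in `Λ⁻¹`. -/
theorem apply_eq_zero_of_mem_contSpec {Λ : Set (PontryaginDual G)} (φ : StrongDual ℂ C(G, ℂ))
    (hφ : ∀ γ ∈ Λ⁻¹, φ (conjChar γ) = 0) {f : C(G, ℂ)} (hf : f ∈ contSpec Λ) : φ f = 0 := by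
  -- The value of `F` at $1$ is $\varphi(f)$, and its coefficient at $\gamma$ is $\hat
  -- f(\gamma)\varphi(\gamma)$: the first factor vanishes for $\gamma\notin\Lambda$, the second for
  -- $\gamma\in\Lambda$.
  let F : C(G, ℂ) := ⟨fun x => φ (shift f x), φ.continuous.comp (shift f).continuous⟩
  have hF : F = 0 := eq_zero_of_fourierCoef_eq_zero F fun γ => by
    have hint : Integrable (fun x => conj (γ x : ℂ) • shift f x) (normHaar G) :=
      integrable_of_continuous ((continuous_conj_character γ).smul (shift f).continuous)
    have h : fourierCoef F γ = φ (fourierCoef f γ • conjChar γ⁻¹) := by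
      rw [← integral_conj_smul_shift, ← φ.integral_comp_comm hint]
      simp only [map_smul]
      rfl
    rw [h, map_smul, smul_eq_mul, mul_eq_zero]
    by_cases h0 : fourierCoef f γ = 0
    · exact Or.inl h0
    · exact Or.inr (hφ _ (by simpa using hf γ h0))
  have h1 : shift f 1 = f := by
    ext x
    rw [shift_apply, one_mul]
  rw [← h1]
  exact congrArg (fun F : C(G, ℂ) => F 1) hF

theorem norm_comp_mkQL {E : Type*} [NormedAddCommGroup E] [NormedSpace ℂ E] (S : Submodule ℂ E)
    [IsClosed (S : Set E)] (φ : StrongDual ℂ (E ⧸ S)) : ‖φ.comp S.mkQL‖ = ‖φ‖ := by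
  apply le_antisymm
  · refine ContinuousLinearMap.opNorm_le_bound _ φ.opNorm_nonneg fun x => ?_
    exact φ.le_opNorm_of_le (Submodule.Quotient.norm_mk_le S x)
  · refine φ.opNorm_le_bound (norm_nonneg _) fun q => le_of_forall_pos_le_add fun ε hε => ?_
    obtain ⟨x, rfl, hx⟩ := Submodule.Quotient.norm_mk_lt q
      (ε := ε / (‖φ.comp S.mkQL‖ + 1)) (by positivity)
    refine ((φ.comp S.mkQL).le_opNorm_of_le hx.le).trans ?_
    rw [mul_add, ← mul_div_assoc]
    gcongr
    rw [div_le_iff₀ (by positivity)]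
    nlinarith [norm_nonneg (φ.comp S.mkQL)]

variable (Λ : Set (PontryaginDual G))

/-- The isometry of the dual of `C(G)/C_Λ(G)` onto the space of regular measures with spectrum
outside `Λ⁻¹`. -/
def quotientDualMeasure : StrongDual ℂ (C(G, ℂ) ⧸ contSpec Λ) →ₗ[ℂ] ComplexMeasure G where
  toFun φ := representingMeasure (φ.comp (contSpec Λ).mkQL)
  map_add' φ ψ := by rw [ContinuousLinearMap.add_comp, representingMeasure_add]
  map_smul' c φ := by rw [ContinuousLinearMap.smul_comp, representingMeasure_smul]; rfl

theorem cintegral_quotientDualMeasure (φ : StrongDual ℂ (C(G, ℂ) ⧸ contSpec Λ)) (f : C(G, ℂ)) :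
    cintegral (quotientDualMeasure Λ φ) f = φ (Submodule.Quotient.mk f) :=
  cintegral_representingMeasure _ f

theorem variation_quotientDualMeasure (φ : StrongDual ℂ (C(G, ℂ) ⧸ contSpec Λ)) :
    (quotientDualMeasure Λ φ).variation Set.univ = ENNReal.ofReal ‖φ‖ := by
  rw [← norm_comp_mkQL]
  exact variation_representingMeasure_univ _

/-- The conjugates of characters in $\Lambda^{-1}$ lie in $C_\Lambda(G)$, which restricts the
spectrum; conversely, a functional killing them kills $C_\Lambda(G)$ and descends to the quotient.
-/
theorem range_quotientDualMeasure : Set.range (quotientDualMeasure Λ) = measSpec (Λ⁻¹)ᶜ := by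
  ext μ
  constructor
  · rintro ⟨φ, rfl⟩
    refine ⟨regular_variation_representingMeasure _, fun γ hγ hΛ => hγ ?_⟩
    refine (cintegral_quotientDualMeasure Λ φ (conjChar γ)).trans ?_
    rw [(Submodule.Quotient.mk_eq_zero _).2 (conjChar_mem_contSpec hΛ), map_zero]
  · rintro ⟨hreg, hμ⟩
    obtain ⟨φ, rfl⟩ := exists_representingMeasure_eq μ
    have hφ : ∀ γ ∈ Λ⁻¹, φ (conjChar γ) = 0 := fun γ hγ => by
      by_contra h
      rw [← cintegral_representingMeasure] at h
      exact hμ γ h hγ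
    refine ⟨(contSpec Λ).liftQL φ fun f hf => apply_eq_zero_of_mem_contSpec φ hφ hf, ?_⟩
    refine congrArg representingMeasure ?_
    ext f
    rfl

end Annihilator

/-! ### The Daugavet property tested on the dual space. -/

section DaugavetCriterion

/-- A dual criterion for the Daugavet property. -/
theorem daugavetProperty_of_dual {X : Type*} [NormedAddCommGroup X] [NormedSpace ℂ X]
    [CompleteSpace X] (h : ∀ (φ : StrongDual ℂ X) (x : X), ‖x‖ = 1 → ∀ ε : ℝ, 0 < ε →
      ∃ ψ : StrongDual ℂ X, ‖ψ‖ ≤ 1 ∧ ‖ψ x - 1‖ ≤ ε ∧ ‖φ‖ + 1 - ε ≤ ‖φ + ψ‖) :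
    DaugavetProperty X := by
  intro T hT
  obtain ⟨v, hv0, hv⟩ := finrank_eq_one_iff'.1 hT
  have hv1 : ‖(v : X)‖ ≠ 0 := norm_ne_zero_iff.2 fun h => hv0 (Subtype.ext h)
  let x : X := ((‖(v : X)‖⁻¹ : ℝ) : ℂ) • (v : X)
  have hx : ‖x‖ = 1 := by
    rw [norm_smul, Complex.norm_real, norm_inv, norm_norm, inv_mul_cancel₀ hv1]
  obtain ⟨g, -, hg⟩ := exists_dual_vector ℂ x (by rw [hx]; exact one_ne_zero)
  rw [hx] at hg
  let φ : StrongDual ℂ X := g.comp T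
  have hTφ : ∀ y, T y = φ y • x := fun y => by
    obtain ⟨c, hc⟩ := hv ⟨T y, y, rfl⟩
    have hc' : T y = (c * ‖(v : X)‖) • x := by
      have h1 : c • (v : X) = T y := congrArg Subtype.val hc
      rw [← h1, smul_smul, mul_assoc]
      rw [Complex.ofReal_inv, mul_inv_cancel₀ (by exact_mod_cast hv1), mul_one]
    change T y = g (T y) • x
    rw [hc', map_smul, hg]
    simp
  have hnorm : ‖T‖ = ‖φ‖ := by
    refine le_antisymm (T.opNorm_le_bound (norm_nonneg _) fun y => ?_)
      (φ.opNorm_le_bound (norm_nonneg _) fun y => ?_)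
    · rw [hTφ, norm_smul, hx, mul_one]
      exact φ.le_opNorm y
    · refine le_trans (le_of_eq ?_) (T.le_opNorm y)
      rw [hTφ, norm_smul, hx, mul_one]
  refine le_antisymm ((norm_add_le _ _).trans
    (add_le_add_left ContinuousLinearMap.norm_id_le _)) ?_
  rw [hnorm]
  refine le_of_forall_pos_le_add fun ε hε => ?_
  obtain ⟨ψ, hψ, hψx, hφψ⟩ := h φ x hx (ε / (‖φ‖ + 1)) (by positivity)
  set δ := ε / (‖φ‖ + 1) with hδ
  -- With $T=\varphi\otimes x$, the functional $\psi\circ(\mathrm{Id}+T)=\psi+\psi(x)\varphi$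
  -- differs from $\varphi+\psi$ by $(\psi(x)-1)\varphi$. The total loss is
  -- $\delta\|\varphi\|+\delta=\varepsilon$.
  have key : ‖φ + ψ‖ ≤ ‖ContinuousLinearMap.id ℂ X + T‖ + δ * ‖φ‖ := by
    refine ContinuousLinearMap.opNorm_le_bound _ (by positivity) fun y => ?_
    have e : (φ + ψ) y = ψ ((ContinuousLinearMap.id ℂ X + T) y) - φ y * (ψ x - 1) := by
      simp only [_root_.add_apply, ContinuousLinearMap.id_apply, map_add, hTφ, map_smul,
        smul_eq_mul]
      ring
    rw [e, add_mul]
    refine (norm_sub_le _ _).trans (add_le_add ?_ ?_)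
    · refine (ψ.le_opNorm _).trans ((mul_le_of_le_one_left (norm_nonneg _) hψ).trans ?_)
      exact ContinuousLinearMap.le_opNorm _ _
    · rw [norm_mul, mul_comm]
      exact (mul_le_mul hψx (φ.le_opNorm y) (norm_nonneg _) (by positivity)).trans_eq
        (mul_assoc _ _ _).symm
  have : δ * (‖φ‖ + 1) = ε := div_mul_cancel₀ _ (by positivity)
  linarith

/-- If `x₁` and `z` are unit vectors with `‖x₁ + z‖` almost `2`, then `‖a x₁ + z‖` is almost
`a + 1`. -/
theorem le_norm_smul_add {E : Type*} [NormedAddCommGroup E] [NormedSpace ℂ E] {x z : E} {a δ : ℝ}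
    (ha : 0 ≤ a) (hδ : 0 ≤ δ) (hx : ‖x‖ = 1) (hz : ‖z‖ = 1) (h : 2 - δ ≤ ‖x + z‖) :
    a + 1 - (1 + a) * δ ≤ ‖(a : ℂ) • x + z‖ := by
  -- For $a\le 1$ subtract $(1-a)x$ from $x+z$, losing `δ`; for $a\ge 1$ subtract $(a-1)z$ from
  -- $a(x+z)$, losing `a * δ`.
  rcases le_total a 1 with h1 | h1
  · have e : (a : ℂ) • x + z = (x + z) - ((1 - a : ℝ) : ℂ) • x := by
      push_cast
      module
    have h2 := norm_sub_norm_le (x + z) (((1 - a : ℝ) : ℂ) • x)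
    rw [norm_smul, Complex.norm_real, Real.norm_of_nonneg (by linarith), hx] at h2
    rw [e]
    nlinarith
  · have e : (a : ℂ) • x + z = (a : ℂ) • (x + z) - ((a - 1 : ℝ) : ℂ) • z := by
      push_cast
      module
    have h2 := norm_sub_norm_le ((a : ℂ) • (x + z)) (((a - 1 : ℝ) : ℂ) • z)
    rw [norm_smul, norm_smul, Complex.norm_real, Real.norm_of_nonneg ha, Complex.norm_real,
      Real.norm_of_nonneg (by linarith), hz] at h2
    rw [e]
    nlinarith

end DaugavetCriterion

/-! ### Separating the singular part of a functional. -/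

section LebesgueDecomposition

variable {X : Type*} [TopologicalSpace X] [CompactSpace X] [T2Space X] [MeasurableSpace X]
  [BorelSpace X]

/-- The norm of a functional `φ` on `C(X)` perturbed by an `L¹(m)` density `z` only depends on the
absolutely continuous part `u` of `φ`. -/
theorem exists_absolutelyContinuous_part (φ : StrongDual ℂ C(X, ℂ)) (m : Measure X)
    [IsFiniteMeasure m] [m.Regular] : ∃ u : X → ℂ, Integrable u m ∧
      ∀ z : X → ℂ, Integrable z m → ∀ ψ : StrongDual ℂ C(X, ℂ),
        (∀ f : C(X, ℂ), ψ f = ∫ x, f x * z x ∂m) →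
        ‖φ‖ - ∫ x, ‖u x‖ ∂m + ∫ x, ‖u x + z x‖ ∂m ≤ ‖φ + ψ‖ := by
  obtain ⟨h, hh, hone, hφ, hmass⟩ := exists_unimodular_density φ
  set ρ := modulusMeasure φ
  obtain ⟨A, hA, hsA, hmA⟩ := ρ.mutuallySingular_singularPart m
  have hs : ρ.singularPart m = ρ.restrict Aᶜ :=
    Measure.singularPart_eq_restrict (by rwa [compl_compl]) hmA
  have hdec : ρ = ρ.restrict Aᶜ + m.withDensity (ρ.rnDeriv m) := by
    rw [← hs]
    exact ρ.haveLebesgueDecomposition_add m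
  set s := ρ.restrict Aᶜ
  have hhs : Integrable h s := hh.restrict
  have hlt : ∀ᵐ x ∂m, ρ.rnDeriv m x < ⊤ := ρ.rnDeriv_lt_top m
  have hmeas : Measurable (ρ.rnDeriv m) := Measure.measurable_rnDeriv ρ m
  have hw : ∀ {E : Type} [NormedAddCommGroup E] [NormedSpace ℝ E] (F : X → E), Integrable F ρ →
      Integrable (fun x => (ρ.rnDeriv m x).toReal • F x) m ∧
      ∫ x, F x ∂ρ = ∫ x, F x ∂s + ∫ x, (ρ.rnDeriv m x).toReal • F x ∂m := fun F hF => by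
    have hF' := hF
    rw [hdec, integrable_add_measure] at hF'
    refine ⟨(integrable_withDensity_iff_integrable_smul' hmeas hlt).1 hF'.2, ?_⟩
    conv_lhs => rw [hdec]
    rw [integral_add_measure hF'.1 hF'.2, integral_withDensity_eq_integral_toReal_smul hmeas hlt]
  obtain ⟨hu, -⟩ := hw h hh
  refine ⟨fun x => (ρ.rnDeriv m x).toReal • h x, hu, fun z hz ψ hψ => ?_⟩
  set u : X → ℂ := fun x => (ρ.rnDeriv m x).toReal • h x with hu_def
  classical
  -- The density of $\varphi+\psi$ with respect to $s+m$: `s` lives off `A` and `m` on `A`. So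
  -- $\|\varphi+\psi\|\ge\int|h|\,ds+\int|u+z|\,dm$, to be compared with
  -- $\|\varphi\|=\int|h|\,ds+\int|u|\,dm$.
  let H : X → ℂ := A.piecewise (fun x => u x + z x) h
  have hsA' : ∀ᵐ x ∂s, x ∈ Aᶜ := ae_restrict_mem hA.compl
  have hmA' : ∀ᵐ x ∂m, x ∈ A := by
    rw [ae_iff]
    exact hmA
  have hHs : H =ᵐ[s] h := hsA'.mono fun x hx => Set.piecewise_eq_of_notMem _ _ _ hx
  have hHm : H =ᵐ[m] fun x => u x + z x := hmA'.mono fun x hx => Set.piecewise_eq_of_mem _ _ _ hx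
  have hHsi : Integrable H s := hhs.congr hHs.symm
  have hHmi : Integrable H m := (hu.add hz).congr hHm.symm
  have key : ∫ x, ‖H x‖ ∂(s + m) ≤ ‖φ + ψ‖ := by
    refine integral_norm_le_of_forall_integral_le (integrable_add_measure.2 ⟨hHsi, hHmi⟩)
      fun f hf => ?_
    have e : ∫ x, f x * H x ∂(s + m) = (φ + ψ) f := by
      rw [integral_add_measure (integrable_continuous_mul hHsi f)
        (integrable_continuous_mul hHmi f), _root_.add_apply, hφ, hψ,
        (hw _ (integrable_continuous_mul hh f)).2, add_assoc, ← integral_add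
        (hw _ (integrable_continuous_mul hh f)).1 (integrable_continuous_mul hz f)]
      congr 1
      · exact integral_congr_ae (hHs.mono fun x hx => by simp only [hx])
      · refine integral_congr_ae (hHm.mono fun x hx => ?_)
        simp only [hx, hu_def, Complex.real_smul]
        ring
    rw [e]
    exact ((φ + ψ).le_opNorm f).trans (mul_le_of_le_one_right (norm_nonneg _) hf)
  rw [integral_add_measure hHsi.norm hHmi.norm] at key
  have e1 : ∫ x, ‖H x‖ ∂s = ∫ x, ‖h x‖ ∂s :=
    integral_congr_ae (hHs.mono fun x hx => by simp only [hx])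
  have e2 : ∫ x, ‖H x‖ ∂m = ∫ x, ‖u x + z x‖ ∂m :=
    integral_congr_ae (hHm.mono fun x hx => by simp only [hx])
  have e3 : ∫ x, ‖h x‖ ∂ρ = ‖φ‖ := by
    rw [integral_congr_ae hone, ← hmass]
    simp
  have e4 : ∫ x, (ρ.rnDeriv m x).toReal • ‖h x‖ ∂m = ∫ x, ‖u x‖ ∂m := by
    refine integral_congr_ae (Filter.Eventually.of_forall fun x => ?_)
    simp only [hu_def, norm_smul, Real.norm_of_nonneg ENNReal.toReal_nonneg, smul_eq_mul]
  have e5 := (hw _ hh.norm).2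
  rw [e3, e4] at e5
  rw [e1, e2] at key
  linarith

end LebesgueDecomposition

/-! ### Convolution, smoothing of functionals, and the pairing of $L^1(G)$ with $C(G)$. -/

section Approximation

variable {G : Type*} [CommGroup G] [TopologicalSpace G] [IsTopologicalGroup G] [CompactSpace G]
  [T2Space G] [MeasurableSpace G] [BorelSpace G]

/-- The convolution of two continuous functions. -/
def convolve (k u : C(G, ℂ)) : C(G, ℂ) := ∫ t, u t • shift k t⁻¹ ∂normHaar G

theorem integrable_smul_shift_inv (k u : C(G, ℂ)) :
    Integrable (fun t => u t • shift k t⁻¹) (normHaar G) :=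
  integrable_of_continuous (u.continuous.smul ((shift k).continuous.comp continuous_inv))

theorem convolve_apply (k u : C(G, ℂ)) (x : G) :
    convolve k u x = ∫ y, k y * u (y⁻¹ * x) ∂normHaar G := by
  refine ((ContinuousMap.evalCLM ℂ x).integral_comp_comm (integrable_smul_shift_inv k u)).symm.trans
    ?_
  rw [← integral_div_left_eq_self (fun y => k y * u (y⁻¹ * x)) (normHaar G) x]
  refine integral_congr_ae (Filter.Eventually.of_forall fun t => ?_)
  change u t * k (t⁻¹ * x) = k (x / t) * u ((x / t)⁻¹ * x)
  rw [mul_comm, inv_div, div_mul_cancel, div_eq_inv_mul]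

theorem apply_convolve (φ : StrongDual ℂ C(G, ℂ)) (k u : C(G, ℂ)) :
    φ (convolve k u) = ∫ t, u t * φ (shift k t⁻¹) ∂normHaar G := by
  rw [convolve, ← φ.integral_comp_comm (integrable_smul_shift_inv k u)]
  simp only [map_smul, smul_eq_mul]

/-- This is why smoothing a functional by convolution does not enlarge its spectrum. -/
theorem convolve_conjChar (k : C(G, ℂ)) (γ : PontryaginDual G) :
    convolve k (conjChar γ) = (∫ y, k y * conjChar γ y⁻¹ ∂normHaar G) • conjChar γ := by
  ext x
  rw [convolve_apply, ContinuousMap.smul_apply, smul_eq_mul, ← integral_mul_const]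
  simp only [conjChar_mul_apply, mul_assoc]

theorem exists_approximate_unit {U : Set G} (hU : U ∈ nhds (1 : G)) :
    ∃ k : C(G, ℝ), (∀ x, 0 ≤ k x) ∧ (∀ x ∉ U, k x = 0) ∧ ∫ x, k x ∂normHaar G = 1 := by
  obtain ⟨V, hVU, hVo, h1V⟩ := mem_nhds_iff.1 hU
  obtain ⟨k, hk0, hk1, hk⟩ := exists_continuous_zero_one_of_isClosed hVo.isClosed_compl
    (isClosed_singleton (x := (1 : G))) (by simpa using h1V)
  have hi : Integrable k (normHaar G) := integrable_of_continuous k.continuous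
  have hpos : 0 < ∫ x, k x ∂normHaar G := by
    refine k.continuous.integral_pos_of_hasCompactSupport_nonneg_nonzero
      (HasCompactSupport.of_compactSpace _) (fun x => (hk x).1) (x := 1) ?_
    rw [hk1 rfl]
    exact one_ne_zero
  refine ⟨(∫ x, k x ∂normHaar G)⁻¹ • k, fun x => ?_, fun x hx => ?_, ?_⟩
  · exact mul_nonneg (inv_nonneg.2 hpos.le) (hk x).1
  · have : k x = 0 := hk0 fun h => hx (hVU h)
    simp [this]
  · simp only [ContinuousMap.smul_apply, smul_eq_mul, integral_const_mul]
    exact inv_mul_cancel₀ hpos.ne'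

/-- A functional on `C(G)` annihilating `C_Λ(G)` is approximated at a given function by an element
of `L¹` with spectrum outside `Λ⁻¹` and with no larger norm. -/
theorem exists_continuous_density_approx {Λ : Set (PontryaginDual G)} (φ : StrongDual ℂ C(G, ℂ))
    (hφ : ∀ γ ∈ Λ⁻¹, φ (conjChar γ) = 0) (f : C(G, ℂ)) {ε : ℝ} (hε : 0 < ε) :
    ∃ g : C(G, ℂ), ∫ x, ‖g x‖ ∂normHaar G ≤ ‖φ‖ ∧ ‖∫ x, f x * g x ∂normHaar G - φ f‖ ≤ ε ∧
      ∀ γ ∈ Λ⁻¹, fourierCoef g γ = 0 := by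
  let δ := ε / (‖φ‖ + 1)
  have hδ : 0 < δ := by positivity
  have h1 : shift f (1 : G)⁻¹ = f := by
    ext x
    simp
  have hU : {y : G | ‖shift f y⁻¹ - f‖ < δ} ∈ nhds (1 : G) := by
    have hc : Continuous fun y : G => ‖shift f y⁻¹ - f‖ :=
      (((shift f).continuous.comp continuous_inv).sub continuous_const).norm
    refine (isOpen_lt hc continuous_const).mem_nhds ?_
    change ‖shift f (1 : G)⁻¹ - f‖ < δ
    rwa [h1, sub_self, norm_zero]
  obtain ⟨k₀, hk0, hkU, hk1⟩ := exists_approximate_unit hU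
  let k : C(G, ℂ) := ⟨fun x => (k₀ x : ℂ), by fun_prop⟩
  have hkn : ∀ x, ‖k x‖ = k₀ x := fun x => by
    simp only [k, ContinuousMap.coe_mk, Complex.norm_real, Real.norm_of_nonneg (hk0 x)]
  have hki : Integrable k₀ (normHaar G) := integrable_of_continuous k₀.continuous
  -- Integration against `g` is $u\mapsto\varphi(k*u)$. As `k` is a probability density,
  -- $\|k*u\|\le\|u\|$; as it is supported where translation moves `f` by less than `δ`, $k*f$ is
  -- within `δ` of `f`.
  let g : C(G, ℂ) := ⟨fun t => φ (shift k t⁻¹),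
    φ.continuous.comp ((shift k).continuous.comp continuous_inv)⟩
  have hg : ∀ u : C(G, ℂ), ∫ x, u x * g x ∂normHaar G = φ (convolve k u) := fun u =>
    (apply_convolve φ k u).symm
  have hbound : ∀ (v : G → ℂ) (C : ℝ), (∀ y, ‖k y * v y‖ ≤ C * k₀ y) →
      ‖∫ y, k y * v y ∂normHaar G‖ ≤ C := fun v C h => by
    refine (norm_integral_le_of_norm_le (hki.const_mul C) (Filter.Eventually.of_forall h)).trans_eq
      ?_
    rw [integral_const_mul, hk1, mul_one]
  refine ⟨g, ?_, ?_, fun γ hγ => ?_⟩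
  · refine integral_norm_le_of_forall_integral_le (integrable_continuousMap g) fun u hu => ?_
    rw [hg]
    refine (φ.le_opNorm _).trans (mul_le_of_le_one_right (norm_nonneg _) ?_)
    refine (ContinuousMap.norm_le _ zero_le_one).2 fun x => ?_
    rw [convolve_apply]
    refine hbound _ 1 fun y => ?_
    rw [norm_mul, hkn, one_mul]
    exact mul_le_of_le_one_right (hk0 y) ((u.norm_coe_le_norm _).trans hu)
  · rw [hg, ← map_sub]
    have hle : ‖convolve k f - f‖ ≤ δ := by
      refine (ContinuousMap.norm_le _ hδ.le).2 fun x => ?_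
      have e : (convolve k f - f) x = ∫ y, k y * (f (y⁻¹ * x) - f x) ∂normHaar G := by
        have hk1' : ∫ y, k y ∂normHaar G = 1 := by
          have := integral_complex_ofReal (μ := normHaar G) (f := k₀)
          rw [hk1, Complex.ofReal_one] at this
          exact this
        have hi : Integrable (fun y => k y * f (y⁻¹ * x)) (normHaar G) :=
          integrable_of_continuous (by fun_prop)
        have hi2 : Integrable (fun y => k y * f x) (normHaar G) :=
          integrable_of_continuous (by fun_prop)
        simp only [mul_sub]
        rw [integral_sub hi hi2, integral_mul_const, hk1', one_mul, ContinuousMap.sub_apply,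
          convolve_apply]
      rw [e]
      refine hbound _ δ fun y => ?_
      rw [norm_mul, hkn, mul_comm]
      by_cases hy : y ∈ {y : G | ‖shift f y⁻¹ - f‖ < δ}
      · exact mul_le_mul_of_nonneg_right
          (((shift f y⁻¹ - f).norm_coe_le_norm x).trans (le_of_lt hy)) (hk0 y)
      · rw [hkU y hy, mul_zero, mul_zero]
    refine (φ.le_opNorm_of_le hle).trans ?_
    simp only [δ]
    rw [← mul_div_assoc, div_le_iff₀ (by positivity)]
    nlinarith [norm_nonneg φ]
  · have h := hg (conjChar γ)
    rw [convolve_conjChar, map_smul, hφ γ hγ, smul_zero] at h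
    exact h

/-- Integration against a function in `L¹(G)` as a functional on `C(G)`. -/
def pairing (u : LOne G) : StrongDual ℂ C(G, ℂ) := LinearMap.mkContinuous
  { toFun := fun f => ∫ x, f x * u x ∂normHaar G
    map_add' := fun f g => by
      simp only [ContinuousMap.add_apply, add_mul]
      exact integral_add (integrable_continuous_mul (L1.integrable_coeFn u) f)
        (integrable_continuous_mul (L1.integrable_coeFn u) g)
    map_smul' := fun c f => by
      simp only [ContinuousMap.smul_apply, smul_mul_assoc]
      exact integral_smul c _ } ‖u‖ fun f => by
  rw [mul_comm, L1.norm_eq_integral_norm, ← integral_const_mul]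
  refine (norm_integral_le_integral_norm _).trans (integral_mono
    (integrable_continuous_mul (L1.integrable_coeFn u) f).norm
    ((L1.integrable_coeFn u).norm.const_mul _) fun x => ?_)
  simp only [norm_mul]
  exact mul_le_mul_of_nonneg_right (f.norm_coe_le_norm x) (norm_nonneg _)

theorem pairing_apply (u : LOne G) (f : C(G, ℂ)) :
    pairing u f = ∫ x, f x * u x ∂normHaar G := rfl

theorem norm_pairing_le (u : LOne G) : ‖pairing u‖ ≤ ‖u‖ :=
  LinearMap.mkContinuous_norm_le _ (norm_nonneg _) _

theorem pairing_add (u v : LOne G) : pairing (u + v) = pairing u + pairing v := by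
  ext f
  rw [_root_.add_apply, pairing_apply, pairing_apply, pairing_apply,
    ← integral_add (integrable_continuous_mul (L1.integrable_coeFn u) f)
      (integrable_continuous_mul (L1.integrable_coeFn v) f)]
  refine integral_congr_ae ((Lp.coeFn_add u v).mono fun x hx => ?_)
  simp only [hx, Pi.add_apply, mul_add]

theorem pairing_smul (c : ℂ) (u : LOne G) : pairing (c • u) = c • pairing u := by
  ext f
  rw [_root_.smul_apply, pairing_apply, pairing_apply, smul_eq_mul, ← integral_const_mul]
  refine integral_congr_ae ((Lp.coeFn_smul c u).mono fun x hx => ?_)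
  simp only [hx, Pi.smul_apply, smul_eq_mul, mul_left_comm]

theorem pairing_toL1 {u : G → ℂ} (hu : Integrable u (normHaar G)) (f : C(G, ℂ)) :
    pairing (hu.toL1 u) f = ∫ x, f x * u x ∂normHaar G :=
  integral_congr_ae (hu.coeFn_toL1.mono fun x hx => by simp only [hx])

/-- The functional on `L¹(G)` given by a continuous function. -/
def pairingLOne (f : C(G, ℂ)) : StrongDual ℂ (LOne G) := LinearMap.mkContinuous
  { toFun := fun u => pairing u f
    map_add' := fun u v => by rw [pairing_add, _root_.add_apply]
    map_smul' := fun c u => by rw [pairing_smul, _root_.smul_apply]; rfl } ‖f‖ fun u => by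
  rw [mul_comm]
  exact (pairing u).le_of_opNorm_le (norm_pairing_le u) f

theorem pairingLOne_apply (f : C(G, ℂ)) (u : LOne G) : pairingLOne f u = pairing u f := rfl

theorem norm_pairingLOne_le (f : C(G, ℂ)) : ‖pairingLOne f‖ ≤ ‖f‖ :=
  LinearMap.mkContinuous_norm_le _ (norm_nonneg _) _

variable {Λ : Set (PontryaginDual G)}

theorem pairing_conjChar {u : LOne G} (hu : u ∈ lOneSpec (Λ⁻¹)ᶜ) {γ : PontryaginDual G}
    (hγ : γ ∈ Λ⁻¹) : pairing u (conjChar γ) = 0 := by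
  by_contra h
  exact hu γ h hγ

theorem contSpec_le_ker_pairing {u : LOne G} (hu : u ∈ lOneSpec (Λ⁻¹)ᶜ) :
    contSpec Λ ≤ (pairing u : C(G, ℂ) →ₗ[ℂ] ℂ).ker := fun _ hf =>
  apply_eq_zero_of_mem_contSpec (pairing u) (fun _ hγ => pairing_conjChar hu hγ) hf

/-- Functions in `L¹(G)` with spectrum outside `Λ⁻¹` act on `C(G)/C_Λ(G)`. -/
def quotientPairing {u : LOne G} (hu : u ∈ lOneSpec (Λ⁻¹)ᶜ) :
    StrongDual ℂ (C(G, ℂ) ⧸ contSpec Λ) :=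
  (contSpec Λ).liftQL (pairing u) (contSpec_le_ker_pairing hu)

theorem quotientPairing_comp_mkQL {u : LOne G} (hu : u ∈ lOneSpec (Λ⁻¹)ᶜ) :
    (quotientPairing hu).comp (contSpec Λ).mkQL = pairing u := by
  ext f
  rfl

theorem quotientPairing_mk {u : LOne G} (hu : u ∈ lOneSpec (Λ⁻¹)ᶜ) (f : C(G, ℂ)) :
    quotientPairing hu (Submodule.Quotient.mk f) = pairing u f := rfl

theorem norm_quotientPairing_le {u : LOne G} (hu : u ∈ lOneSpec (Λ⁻¹)ᶜ) :
    ‖quotientPairing hu‖ ≤ ‖u‖ := by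
  rw [← norm_comp_mkQL, quotientPairing_comp_mkQL]
  exact norm_pairing_le u

end Approximation

/-! ### The Daugavet property of $C(G)/C_\Lambda(G)$. -/

section Main

variable {G : Type*} [CommGroup G] [TopologicalSpace G] [IsTopologicalGroup G] [CompactSpace G]
  [T2Space G] [MeasurableSpace G] [BorelSpace G]

variable {Λ : Set (PontryaginDual G)}

/-- Unit vectors of `C(G)/C_Λ(G)` are almost normed by unit vectors of `L¹(G)` with spectrum
outside `Λ⁻¹`. -/
theorem exists_unit_mem_lOneSpec {f : C(G, ℂ)}
    (hf : ‖(Submodule.Quotient.mk f : C(G, ℂ) ⧸ contSpec Λ)‖ = 1) {δ : ℝ} (hδ : 0 < δ)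
    (hδ1 : δ < 1) :
    ∃ y ∈ lOneSpec (Λ⁻¹)ᶜ, ‖y‖ = 1 ∧ ‖pairing y f - 1‖ ≤ 2 * δ := by
  obtain ⟨φ, hφ, hφf⟩ := exists_dual_vector ℂ
    (Submodule.Quotient.mk f : C(G, ℂ) ⧸ contSpec Λ) (by rw [hf]; exact one_ne_zero)
  rw [hf, RCLike.ofReal_one] at hφf
  obtain ⟨g, hg1, hgf, hgΛ⟩ := exists_continuous_density_approx (Λ := Λ)
    (φ.comp (contSpec Λ).mkQL) (fun γ hγ => by
      refine Eq.trans ?_ (map_zero φ)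
      exact congrArg φ ((Submodule.Quotient.mk_eq_zero _).2 (conjChar_mem_contSpec hγ))) f hδ
  rw [norm_comp_mkQL, hφ] at hg1
  have hgf' : ‖∫ x, f x * g x ∂normHaar G - 1‖ ≤ δ := by
    rw [← hφf]
    exact hgf
  have hgi := integrable_continuousMap g
  let u : LOne G := hgi.toL1 g
  have hu : u ∈ lOneSpec (Λ⁻¹)ᶜ := fun γ hγ hΛ => hγ <| by
    rw [fourierCoef_congr hgi.coeFn_toL1, hgΛ γ hΛ]
  have hu1 : ‖u‖ ≤ 1 := by
    rw [L1.norm_eq_integral_norm, integral_congr_ae (hgi.coeFn_toL1.mono fun x hx => by rw [hx])]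
    exact hg1
  have huf : ‖pairing u f - 1‖ ≤ δ := by rwa [pairing_toL1 hgi]
  -- Since `u` acts on the quotient, the class of `f`, of norm one, counts here, not `f` itself.
  -- Hence `‖u‖` lies between `1 - δ` and `1`, and normalizing `u` costs only one more `δ`.
  have hle : ‖pairing u f‖ ≤ ‖u‖ := by
    rw [← quotientPairing_mk hu]
    exact ((quotientPairing hu).le_of_opNorm_le (norm_quotientPairing_le hu) _).trans_eq
      (by rw [hf, mul_one])
  have hge : 1 - δ ≤ ‖u‖ := by
    have h := norm_sub_norm_le (1 : ℂ) (1 - pairing u f)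
    rw [sub_sub_cancel, norm_one, norm_sub_rev] at h
    linarith
  have hpos : 0 < ‖u‖ := by linarith
  refine ⟨((‖u‖⁻¹ : ℝ) : ℂ) • u, Submodule.smul_mem _ _ hu, ?_, ?_⟩
  · rw [norm_smul, Complex.norm_real, norm_inv, norm_norm, inv_mul_cancel₀ hpos.ne']
  · have e : pairing (((‖u‖⁻¹ : ℝ) : ℂ) • u) f - 1 =
        ((‖u‖⁻¹ - 1 : ℝ) : ℂ) * pairing u f + (pairing u f - 1) := by
      rw [pairing_smul, _root_.smul_apply, smul_eq_mul]
      push_cast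
      ring
    rw [e]
    refine (norm_add_le _ _).trans ?_
    have hinv : 1 ≤ ‖u‖⁻¹ := (one_le_inv₀ hpos).2 hu1
    have h1 : ‖((‖u‖⁻¹ - 1 : ℝ) : ℂ) * pairing u f‖ ≤ δ := by
      rw [norm_mul, Complex.norm_real, Real.norm_of_nonneg (by linarith)]
      refine (mul_le_mul_of_nonneg_left hle (by linarith)).trans ?_
      rw [sub_mul, inv_mul_cancel₀ hpos.ne']
      linarith
    linarith

theorem daugavetProperty_quotient_contSpec (hrich : IsRich (lOneSpec (Λ⁻¹)ᶜ)) :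
    DaugavetProperty (C(G, ℂ) ⧸ contSpec Λ) := by
  refine daugavetProperty_of_dual fun φ q hq ε hε => ?_
  obtain ⟨f, rfl, hf⟩ := Submodule.Quotient.norm_mk_lt q (ε := 1) one_pos
  rw [hq] at hf
  obtain ⟨u, hu, hφu⟩ := exists_absolutelyContinuous_part (φ.comp (contSpec Λ).mkQL) (normHaar G)
  set a := ∫ x, ‖u x‖ ∂normHaar G with ha
  have ha0 : 0 ≤ a := integral_nonneg fun x => norm_nonneg _
  -- The errors below add up to `9 * δ` for the value at the class of `f` and to `(5 + a) * δ` for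
  -- the norm.
  let δ := min (1 / 2) (ε / (10 + a))
  have hδ : 0 < δ := by positivity
  have hδ1 : δ < 1 := (min_le_left _ _).trans_lt (by norm_num)
  have hδε : (10 + a) * δ ≤ ε := by
    rw [mul_comm, ← le_div_iff₀ (by positivity)]
    exact min_le_right _ _
  have haδ : 0 ≤ a * δ := by positivity
  obtain ⟨y, hy, hy1, hyf⟩ := exists_unit_mem_lOneSpec hq hδ hδ1
  -- Richness needs a unit vector in the direction of `u`; if `u` is zero any unit vector serves,
  -- for instance `y`.
  obtain ⟨x, hx1, hux⟩ : ∃ x : LOne G, ‖x‖ = 1 ∧ hu.toL1 u = (a : ℂ) • x := by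
    have hnorm : ‖hu.toL1 u‖ = a := by
      rw [L1.norm_eq_integral_norm, integral_congr_ae (hu.coeFn_toL1.mono fun x hx => by rw [hx])]
    rcases eq_or_ne a 0 with h0 | h0
    · refine ⟨y, hy1, ?_⟩
      rw [h0, Complex.ofReal_zero, zero_smul]
      exact norm_eq_zero.1 (hnorm.trans h0)
    · refine ⟨((a⁻¹ : ℝ) : ℂ) • hu.toL1 u, ?_, ?_⟩
      · rw [norm_smul, hnorm, Complex.norm_real, norm_inv, Real.norm_of_nonneg ha0,
          inv_mul_cancel₀ h0]
      · rw [smul_smul, ← Complex.ofReal_mul, mul_inv_cancel₀ h0, Complex.ofReal_one, one_smul]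
  obtain ⟨z, hz1, hzy, hxz⟩ := hrich x y hx1 hy1 (pairingLOne f) δ hδ
  obtain ⟨r, hr, hrδ⟩ := Submodule.Quotient.norm_mk_lt
    ((lOneSpec (Λ⁻¹)ᶜ).mkQL (y - z)) hδ
  have hzy1 : ‖(lOneSpec (Λ⁻¹)ᶜ).mkQL (y - z)‖ ≤ δ :=
    (le_add_of_nonneg_right (norm_nonneg _)).trans hzy
  have hzy2 : ‖pairingLOne f (y - z)‖ ≤ δ :=
    (le_add_of_nonneg_left (norm_nonneg _)).trans hzy
  have hr2 : ‖r‖ ≤ 2 * δ := by linarith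
  -- Here `r` is a short representative of the class of `y - z`, so `w` agrees with `y` modulo the
  -- subspace and therefore belongs to it.
  let w : LOne G := z + r
  have hw : w ∈ lOneSpec (Λ⁻¹)ᶜ := by
    have h1 : r - (y - z) ∈ lOneSpec (Λ⁻¹)ᶜ := (Submodule.Quotient.eq _).1 hr
    have h2 : w = y + (r - (y - z)) := by
      simp only [w]
      abel
    rw [h2]
    exact Submodule.add_mem _ hy h1
  have hw1 : ‖w‖ ≤ 1 + 2 * δ := (norm_add_le _ _).trans (by rw [hz1]; linarith)
  have hwf : ‖pairing w f - 1‖ ≤ 7 * δ := by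
    have e : pairing w f - 1 = (pairing y f - 1) - pairingLOne f (y - z) + pairingLOne f r := by
      simp only [w, ← pairingLOne_apply, map_add, map_sub]
      ring
    have h1 : ‖pairingLOne f r‖ ≤ 2 * (2 * δ) :=
      (ContinuousLinearMap.le_opNorm _ _).trans
        (mul_le_mul ((norm_pairingLOne_le f).trans (by linarith)) hr2 (norm_nonneg _) (by norm_num))
    rw [e]
    refine (norm_add_le _ _).trans ?_
    have h2 := norm_sub_le (pairing y f - 1) (pairingLOne f (y - z))
    linarith
  have hlow : ‖φ‖ + 1 - (1 + a) * δ - 2 * δ ≤ ‖φ + quotientPairing hw‖ := by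
    have h1 := hφu w (L1.integrable_coeFn w) (pairing w) fun g => rfl
    have h2 : ∫ x, ‖u x + w x‖ ∂normHaar G = ‖(a : ℂ) • x + w‖ := by
      rw [← hux, L1.norm_eq_integral_norm]
      refine integral_congr_ae ?_
      filter_upwards [hu.coeFn_toL1, Lp.coeFn_add (hu.toL1 u) w] with t h3 h4
      rw [h4, Pi.add_apply, h3]
    have h3 : ‖φ.comp (contSpec Λ).mkQL + pairing w‖ = ‖φ + quotientPairing hw‖ := by
      rw [← quotientPairing_comp_mkQL hw, ← ContinuousLinearMap.add_comp, norm_comp_mkQL]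
    have h4 := le_norm_smul_add ha0 hδ.le hx1 hz1 hxz
    have h5 : ‖(a : ℂ) • x + z‖ ≤ ‖(a : ℂ) • x + w‖ + ‖r‖ := by
      have e : (a : ℂ) • x + z = ((a : ℂ) • x + w) - r := by
        simp only [w]
        abel
      rw [e]
      exact norm_sub_le _ _
    rw [norm_comp_mkQL, h2, h3] at h1
    linarith
  set Ψ := quotientPairing hw
  have hΨ : ‖Ψ‖ ≤ 1 + 2 * δ := (norm_quotientPairing_le hw).trans hw1
  -- Scaling by `c` brings the functional of `w` into the unit ball and moves it by at most `2 * δ`.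
  let c : ℝ := (1 + 2 * δ)⁻¹
  have hc0 : 0 < c := by positivity
  have hc : c * (1 + 2 * δ) = 1 := inv_mul_cancel₀ (by positivity)
  have hc1 : c ≤ 1 := inv_le_one_of_one_le₀ (by linarith)
  have hc2 : (1 - c) * (1 + 2 * δ) = 2 * δ := by linarith
  have hc3 : 1 - c ≤ 2 * δ := by nlinarith
  refine ⟨(c : ℂ) • Ψ, ?_, ?_, ?_⟩
  · rw [norm_smul, Complex.norm_real, Real.norm_of_nonneg hc0.le, ← hc]
    exact mul_le_mul_of_nonneg_left hΨ hc0.le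
  · have e : ((c : ℂ) • Ψ) (Submodule.Quotient.mk f) - 1 =
        (c : ℂ) * (pairing w f - 1) - ((1 - c : ℝ) : ℂ) := by
      rw [_root_.smul_apply, smul_eq_mul, quotientPairing_mk]
      push_cast
      ring
    rw [e]
    refine (norm_sub_le _ _).trans ?_
    rw [norm_mul, Complex.norm_real, Complex.norm_real, Real.norm_of_nonneg hc0.le,
      Real.norm_of_nonneg (by linarith)]
    have := (mul_le_of_le_one_left (norm_nonneg (pairing w f - 1)) hc1).trans hwf
    linarith
  · have e : φ + Ψ = (φ + (c : ℂ) • Ψ) + ((1 - c : ℝ) : ℂ) • Ψ := by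
      push_cast
      module
    have h1 : ‖((1 - c : ℝ) : ℂ) • Ψ‖ ≤ 2 * δ := by
      refine (ContinuousLinearMap.opNorm_smul_le _ _).trans ?_
      rw [Complex.norm_real, Real.norm_of_nonneg (by linarith), ← hc2]
      exact mul_le_mul_of_nonneg_left hΨ (by linarith)
    have h2 := norm_add_le (φ + (c : ℂ) • Ψ) (((1 - c : ℝ) : ℂ) • Ψ)
    rw [← e] at h2
    linarith

end Main

end

theorem mainTheorem5 {G : Type*} [CommGroup G] [TopologicalSpace G] [IsTopologicalGroup G]
    [CompactSpace G] [T2Space G] [Infinite G] [MeasurableSpace G] [BorelSpace G]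
    (Λ : Set (PontryaginDual G)) :
    (IsRich (lOneSpec (Λ⁻¹)ᶜ) → DaugavetProperty (C(G, ℂ) ⧸ contSpec Λ)) ∧
    ∃ Φ : StrongDual ℂ (C(G, ℂ) ⧸ contSpec Λ) →ₗ[ℂ] ComplexMeasure G,
      Set.range Φ = measSpec (Λ⁻¹)ᶜ ∧
      (∀ φ, (Φ φ).variation Set.univ = ENNReal.ofReal ‖φ‖) ∧
      ∀ φ (f : C(G, ℂ)), φ (Submodule.Quotient.mk f) = cintegral (Φ φ) f :=
  ⟨daugavetProperty_quotient_contSpec, quotientDualMeasure Λ, range_quotientDualMeasure Λ,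
    variation_quotientDualMeasure Λ, fun φ f => (cintegral_quotientDualMeasure Λ φ f).symm⟩
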